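/- Let $K$ be a field, let $m\ge n\ge 0$ be integers, and let $A=\bigoplus_{k\ge 0}A_k$ be an $\mathbb N$-graded (Noetherian) Cohen–Macaulay $K$-algebra with $A_0=K$ and $\dim A=m$ (for instance the Cohen–Macaulay coordinate ring $K[T_0,\dots,T_N]/J$ of a closed subscheme of $\mathbb P^N_K$). Let $h_0,\dots,h_n\in A$ be homogeneous of the same degree $d$, and suppose that the ideal $I=(h_0,\dots,h_n)$ has codimension (height) at least $n-1$, with the convention that the unit ideal has height $\infty$. Assume that $X=\operatorname{Proj}(A/I)\subset\operatorname{Proj}(A)$ is locally defined by $n$ equations (locally an almost complete intersection), i.e. for every homogeneous prime ideal $\mathfrak p\supseteq I$ of $A$ with $\mathfrak p\not\supseteq A_+$ the ideal $I_{\mathfrak p}\subset A_{\mathfrak p}$ can be generated by $n$ elements. Let $(K_\bullet,\delta_\bullet)$, $K_i=\bigwedge^i A^{n+1}$, be the Koszul complex of $h_0,\dots,h_n$ over $A$, let $Z_i=\ker(\delta_i)$ be its module of $i$-cycles ($Z_0=A$), and let $\mathcal Z_\bullet$ be the approximation complex of cycles: $\mathcal Z_i=Z_i\otimes_A A[T_0,\dots,T_n]$,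 with differentials $\epsilon_i:\mathcal Z_i\to\mathcal Z_{i-1}$ obtained from $\delta_i$ by replacing each $h_j$ by the variable $T_j$ (degree shifts are omitted). Then $\mathcal Z_\bullet$ is acyclic: $H_i(\mathcal Z_\bullet)=0$ for all $i>0$. Moreover, if $I$ has height at least $1$ (which is automatic when $n\ge 2$), then $Z_{n+1}=0$, so that $\mathcal Z_\bullet$ is the complex $0\to\mathcal Z_n\to\mathcal Z_{n-1}\to\cdots\to\mathcal Z_1\to\mathcal Z_0$. -/

import Mathlib

open scoped TensorProduct

/-- A Noetherian local ring `R` is Cohen-Macaulay when its maximal ideal contains an `R`-regular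
sequence of length `dim R` (equivalently `depth R = dim R`). -/
def IsCohenMacaulayLocal (R : Type*) [CommRing R] [IsLocalRing R] : Prop :=
  ∃ rs : List R, (∀ r ∈ rs, r ∈ IsLocalRing.maximalIdeal R) ∧
    RingTheory.Sequence.IsRegular R rs ∧ (rs.length : WithBot ℕ∞) = ringKrullDim R

/-- A ring is Cohen-Macaulay when it is Noetherian and all its local rings are Cohen-Macaulay. -/
def IsCohenMacaulay (R : Type*) [CommRing R] : Prop :=
  IsNoetherianRing R ∧
    ∀ (p : Ideal R) [p.IsPrime], IsCohenMacaulayLocal (Localization.AtPrime p)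

namespace ApproximationComplex

variable {A : Type*} [CommRing A] {ι : Type*}

/-- Contraction by a linear form lowers the exterior degree by one. -/
theorem contractLeft_mem (f : Module.Dual A (ι → A)) (i : ℕ) :
    ∀ x : ExteriorAlgebra A (ι → A), x ∈ ⋀[A]^(i + 1) (ι → A) →
      CliffordAlgebra.contractLeft f x ∈ ⋀[A]^i (ι → A) := by
  induction i with
  | zero =>
    intro x hx
    rw [ExteriorAlgebra.exteriorPower, zero_add, pow_one] at hx
    obtain ⟨m, rfl⟩ := hx
    erw [CliffordAlgebra.contractLeft_ι]
    rw [ExteriorAlgebra.exteriorPower, pow_zero]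
    exact Submodule.algebraMap_mem _
  | succ i ih =>
    intro x hx
    rw [ExteriorAlgebra.exteriorPower, pow_succ'] at hx
    refine Submodule.mul_induction_on hx ?_ ?_
    · rintro _ ⟨m, rfl⟩ y hy
      erw [CliffordAlgebra.contractLeft_ι_mul]
      refine Submodule.sub_mem _ (Submodule.smul_mem _ _ hy) ?_
      rw [ExteriorAlgebra.exteriorPower, pow_succ']
      exact Submodule.mul_mem_mul ⟨m, rfl⟩ (ih y hy)
    · intro x y hx hy
      rw [map_add]
      exact Submodule.add_mem _ hx hy

variable [Fintype ι] [DecidableEq ι]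

/-- The linear form `e_j ↦ h j` on the free module with basis `(e_j)`. -/
noncomputable def form (h : ι → A) : Module.Dual A (ι → A) := Fintype.linearCombination A h

/-- The Koszul differential of the sequence `h`, on the whole exterior algebra: the contraction
`e_{j_1} ∧ ⋯ ∧ e_{j_i} ↦ ∑ k, (-1)^(k-1) h_{j_k} e_{j_1} ∧ ⋯ (omit e_{j_k}) ⋯ ∧ e_{j_i}`. -/
noncomputable def koszulD (h : ι → A) :
    ExteriorAlgebra A (ι → A) →ₗ[A] ExteriorAlgebra A (ι → A) :=
  CliffordAlgebra.contractLeft (form h)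

/-- The module `Z_i = ker (δ_i : K_i → K_{i-1})` of Koszul `i`-cycles of `h`, where
`K_i = ⋀^i A^ι`, as a submodule of the exterior algebra; for `i = 0` this is all of `K_0`. -/
noncomputable def cycles (h : ι → A) (i : ℕ) : Submodule A (ExteriorAlgebra A (ι → A)) :=
  ⋀[A]^i (ι → A) ⊓ LinearMap.ker (koszulD h)

/-- The map `Z_{i+1} → Z_i` given by the contraction by the `j`-th coordinate form, i.e. by the
Koszul matrix in which `h j` is replaced by `1` and the other `h k` by `0`. -/
noncomputable def coordContraction (h : ι → A) (i : ℕ) (j : ι) :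
    cycles h (i + 1) →ₗ[A] cycles h i where
  toFun z := ⟨koszulD (Pi.single j 1) z.1, contractLeft_mem _ i _ z.2.1, by
    have hz : CliffordAlgebra.contractLeft (form h) z.1 = 0 := z.2.2
    change CliffordAlgebra.contractLeft (form h)
      (CliffordAlgebra.contractLeft (form (Pi.single j 1)) z.1) = 0
    rw [CliffordAlgebra.contractLeft_comm, hz, map_zero, neg_zero]⟩
  map_add' x y := by ext; simp
  map_smul' c x := by ext; simp

/-- The `i`-th module `𝒵_i = A[T] ⊗_A Z_i` of the approximation complex of cycles, over the
polynomial ring `A[T] = A[T_j : j ∈ ι]`. The degree shifts are omitted. -/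
abbrev ZModule (h : ι → A) (i : ℕ) : Type _ := MvPolynomial ι A ⊗[A] cycles h i

/-- The differential `ε_{i+1} : 𝒵_{i+1} → 𝒵_i` of the approximation complex of cycles: the Koszul
differential in which every `h j` is replaced by the variable `T_j`. -/
noncomputable def epsilon (h : ι → A) (i : ℕ) :
    ZModule h (i + 1) →ₗ[MvPolynomial ι A] ZModule h i :=
  ∑ j : ι, (MvPolynomial.X j : MvPolynomial ι A) •
    (coordContraction h i j).baseChange (MvPolynomial ι A)

/-- Consecutive differentials compose to zero. -/
theorem epsilon_comp_epsilon (h : ι → A) (i : ℕ) (x : ZModule h (i + 2)) :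
    epsilon h i (epsilon h (i + 1) x) = 0 := by
  have key : ∀ (j k : ι) (z : cycles h (i + 2)),
      coordContraction h i j (coordContraction h (i + 1) k z) +
        coordContraction h i k (coordContraction h (i + 1) j z) = 0 := by
    intro j k z
    apply Subtype.ext
    have := CliffordAlgebra.contractLeft_comm (d := form (Pi.single j (1 : A)))
      (d' := form (Pi.single k (1 : A))) z.1
    exact (congrArg (· + _) this).trans (neg_add_cancel _)
  have key' : ∀ (j : ι) (z : cycles h (i + 2)),
      coordContraction h i j (coordContraction h (i + 1) j z) = 0 := by
    intro j z
    apply Subtype.ext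
    exact CliffordAlgebra.contractLeft_contractLeft (d := form (Pi.single j (1 : A))) z.1
  induction x using TensorProduct.induction_on with
  | zero => simp
  | add x y hx hy => rw [map_add, map_add, hx, hy, add_zero]
  | tmul p z =>
    simp only [epsilon, LinearMap.sum_apply, LinearMap.smul_apply, LinearMap.baseChange_tmul,
      map_sum, TensorProduct.smul_tmul']
    rw [← Finset.sum_product']
    refine Finset.sum_involution (fun p _ => (p.2, p.1)) ?_ ?_ (by simp) (by simp)
    · rintro ⟨j, k⟩ -
      dsimp only
      rw [smul_smul, smul_smul, mul_comm, ← TensorProduct.tmul_add, key,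
        TensorProduct.tmul_zero]
    · rintro ⟨j, k⟩ - hne heq
      obtain rfl : k = j := congrArg Prod.fst heq
      exact hne (by dsimp only; rw [key', TensorProduct.tmul_zero])

/-- The approximation complex of cycles `⋯ → 𝒵_2 → 𝒵_1 → 𝒵_0` of `h` is acyclic, i.e. its homology
vanishes in all positive degrees. -/
def IsAcyclic (h : ι → A) : Prop :=
  ∀ i : ℕ, Function.Exact (epsilon h (i + 1)) (epsilon h i)

end ApproximationComplex

/-- For a homogeneous ideal `I` of the `ℕ`-graded ring `A`, the closed subscheme
`X = Proj (A / I)` of `Proj A` is locally defined by `n` equations: at each of its points, i.e. at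
each homogeneous prime `p ⊇ I` not containing the irrelevant ideal, the ideal `I_p` of `A_p` is
generated by `n` elements. -/
def ProjLocallyDefinedBy {A σ : Type*} [CommRing A] [SetLike σ A] [AddSubmonoidClass σ A]
    (𝒜 : ℕ → σ) [GradedRing 𝒜] (I : Ideal A) (n : ℕ) : Prop :=
  ∀ x : ProjectiveSpectrum 𝒜, I ≤ x.asHomogeneousIdeal.toIdeal →
    ∃ f : Fin n → Localization.AtPrime x.asHomogeneousIdeal.toIdeal,
      I.map (algebraMap A (Localization.AtPrime x.asHomogeneousIdeal.toIdeal)) =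
        Ideal.span (Set.range f)

/-! Let `δ` be the Koszul differential of `h` and `ε` that of the variables on `K[T]`. They
anticommute, and `𝒵_i` is the kernel of `δ` in `K_i[T]`. Since `ε` is exact in positive degrees, a
chain `x` with `δ x = ε x = 0` is `ε r`. Then `δ r` is killed by `δ` and `ε` and has smaller degree
in `T`, so by induction `δ r = ε z` with `δ z = 0`. If `z = δ w`, then `r + ε w` is a `δ`-cycle
mapping to `x`. Thus only Koszul homology in degrees at least 2 matters
(`exists_diff_X_eq_of_diff_C_eq_zero`).

In degrees at least 3 it vanishes, as `I` contains a regular sequence of length `n - 1`. In degree 2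
the class of `z` is killed by `ε`, and it must be shown to be zero. Suppose `s * h j` lies in the
ideal of the other generators; the resulting relation among the `h i` shows that a power of `s`
kills the class (`exists_diff_C_eq_pow_smul_of_redundant`). By the local hypothesis and Nakayama,
such `s` generate an ideal whose radical contains `A_+`. The height of `A_+` is `dim A = m > n - 1`
when `n > 0`, so some `y ∈ A_+` extends the regular sequence. It is a nonzerodivisor on the second
Koszul homology (`exists_diff_eq_of_smul`), and a power of it kills the class, which is therefore
zero. -/

namespace FinsetKoszul

/-! ### Contraction and exterior multiplication on functions on finite subsets -/

theorem sum_smul_anticomm {R κ E : Type*} [CommRing R] [Fintype κ] [Ring E] [Algebra R E] (X : κ → E) (Y : κ → E)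
    (z : κ → κ → R) (hXY : ∀ j k, X j * Y k + Y k * X j = algebraMap R E (z j k)) (c d : κ → R) :
    (∑ j, c j • X j) * (∑ k, d k • Y k) + (∑ k, d k • Y k) * (∑ j, c j • X j) =
      algebraMap R E (∑ j, ∑ k, c j * d k * z j k) := by
  rw [Finset.sum_mul_sum, Finset.sum_mul_sum]
  rw [Finset.sum_comm (f := fun k j => d k • Y k * c j • X j), ← Finset.sum_add_distrib, map_sum]
  refine Finset.sum_congr rfl fun j _ => ?_
  rw [← Finset.sum_add_distrib, map_sum]
  refine Finset.sum_congr rfl fun k _ => ?_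
  rw [smul_mul_smul_comm, smul_mul_smul_comm, mul_comm (d k), ← smul_add, hXY, map_mul,
    Algebra.smul_def]

/-- The anticommutator formula would only give twice the square, and 2 may be a zero divisor. -/
theorem sum_smul_mul_self {R κ E : Type*} [CommRing R] [Fintype κ] [Ring E] [Algebra R E] (X : κ → E)
    (hX : ∀ j, X j * X j = 0) (hXX : ∀ j k, X j * X k + X k * X j = 0) (c : κ → R) :
    (∑ j, c j • X j) * (∑ j, c j • X j) = 0 := by
  classical
  suffices H : ∀ s : Finset κ, (∑ j ∈ s, c j • X j) * (∑ j ∈ s, c j • X j) = 0 from H _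
  intro s
  induction s using Finset.induction_on with
  | empty => simp
  | insert a s ha ih =>
    rw [Finset.sum_insert ha, mul_add, add_mul, add_mul, ih, smul_mul_smul_comm, hX, smul_zero,
      zero_add, add_zero, Finset.sum_mul, Finset.mul_sum, ← Finset.sum_add_distrib]
    refine Finset.sum_eq_zero fun j _ => ?_
    rw [smul_mul_smul_comm, smul_mul_smul_comm, mul_comm (c a), ← smul_add, hXX, smul_zero]

variable {R : Type*} [CommRing R] {ι : Type*} [LinearOrder ι] {M : Type*} [AddCommGroup M]
  [Module R M]

/-- The sign of moving the index `j` to its place in the ordered set `S`. -/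
def sgn (R : Type*) [CommRing R] (j : ι) (S : Finset ι) : R := (-1) ^ (S.filter (· < j)).card

theorem sgn_mul_self (j : ι) (S : Finset ι) : sgn R j S * sgn R j S = 1 := by
  rw [sgn, ← mul_pow]; simp

theorem sgn_insert {j k : ι} {S : Finset ι} (hk : k ∉ S) :
    sgn R j (insert k S) = if k < j then -sgn R j S else sgn R j S := by
  rw [sgn, sgn, Finset.filter_insert]
  split_ifs with h
  · rw [Finset.card_insert_of_notMem (by simp [hk]), pow_succ]; ring
  · rfl

theorem sgn_insert_self (j : ι) (S : Finset ι) : sgn R j (insert j S) = sgn R j S := by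
  rw [sgn, sgn, Finset.filter_insert, if_neg (lt_irrefl j)]

theorem sgn_erase_self (j : ι) (S : Finset ι) : sgn R j (S.erase j) = sgn R j S := by
  rw [sgn, sgn, Finset.filter_erase, Finset.erase_eq_of_notMem (by simp)]

/-- Exactly one of the two insertions shifts a sign: that of the smaller index. This is the source
of anticommutation for both contractions and wedges. -/
theorem sgn_mul_sgn_insert {j k : ι} {S : Finset ι} (hjk : j ≠ k) (hj : j ∉ S) (hk : k ∉ S) :
    sgn R j S * sgn R k (insert j S) = -(sgn R k S * sgn R j (insert k S)) := by
  rw [sgn_insert hj, sgn_insert hk]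
  rcases lt_or_gt_of_ne hjk with h | h
  · rw [if_pos h, if_neg h.not_gt]; ring
  · rw [if_neg h.not_gt, if_pos h]; ring

/-- Contraction by the `j`-th coordinate form, on functions on the finite subsets of `ι`. -/
def contract (R M : Type*) [CommRing R] [AddCommGroup M] [Module R M] (j : ι) :
    Module.End R (Finset ι → M) where
  toFun f S := if j ∈ S then 0 else sgn R j S • f (insert j S)
  map_add' f g := by ext S; simp only [Pi.add_apply]; split_ifs <;> simp
  map_smul' c f := by
    ext S; simp only [Pi.smul_apply, RingHom.id_apply]; split_ifs <;> simp [smul_comm c]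

/-- Exterior multiplication by the `j`-th basis vector. -/
def wedge (R M : Type*) [CommRing R] [AddCommGroup M] [Module R M] (j : ι) :
    Module.End R (Finset ι → M) where
  toFun f S := if j ∈ S then sgn R j S • f (S.erase j) else 0
  map_add' f g := by ext S; simp only [Pi.add_apply]; split_ifs <;> simp
  map_smul' c f := by
    ext S; simp only [Pi.smul_apply, RingHom.id_apply]; split_ifs <;> simp [smul_comm c]

theorem contract_apply (j : ι) (f : Finset ι → M) (S : Finset ι) :
    contract R M j f S = if j ∈ S then 0 else sgn R j S • f (insert j S) := rfl

theorem wedge_apply (j : ι) (f : Finset ι → M) (S : Finset ι) :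
    wedge R M j f S = if j ∈ S then sgn R j S • f (S.erase j) else 0 := rfl

theorem contract_mul_self (j : ι) : contract R M j * contract R M j = 0 := by
  ext f S
  simp [contract_apply]

theorem wedge_mul_self (j : ι) : wedge R M j * wedge R M j = 0 := by
  ext f S
  simp [wedge_apply]

theorem contract_anticomm (j k : ι) :
    contract R M j * contract R M k + contract R M k * contract R M j = 0 := by
  rcases eq_or_ne j k with rfl | hjk
  · rw [contract_mul_self, add_zero]
  refine LinearMap.ext fun f => funext fun S => ?_
  simp only [LinearMap.add_apply, Module.End.mul_apply, Pi.add_apply, contract_apply,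
    Finset.mem_insert, hjk, hjk.symm, false_or, LinearMap.zero_apply, Pi.zero_apply]
  by_cases hj : j ∈ S <;> by_cases hk : k ∈ S <;> simp only [hj, hk, if_true, if_false, smul_zero,
    add_zero]
  rw [smul_smul, smul_smul, sgn_mul_sgn_insert hjk hj hk, Finset.insert_comm, ← add_smul,
    neg_add_cancel, zero_smul]

theorem wedge_anticomm (j k : ι) :
    wedge R M j * wedge R M k + wedge R M k * wedge R M j = 0 := by
  rcases eq_or_ne j k with rfl | hjk
  · rw [wedge_mul_self, add_zero]
  refine LinearMap.ext fun f => funext fun S => ?_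
  simp only [LinearMap.add_apply, Module.End.mul_apply, Pi.add_apply, wedge_apply,
    Finset.mem_erase, ne_eq, hjk, hjk.symm, not_false_eq_true, true_and, LinearMap.zero_apply,
    Pi.zero_apply]
  by_cases hj : j ∈ S <;> by_cases hk : k ∈ S <;> simp only [hj, hk, if_true, if_false, smul_zero,
    add_zero]
  obtain ⟨T, hjT, hkT, rfl⟩ : ∃ T, j ∉ T ∧ k ∉ T ∧ S = insert j (insert k T) :=
    ⟨(S.erase j).erase k, by simp, by simp, by
      rw [Finset.insert_erase (by simp [hk, hjk.symm]), Finset.insert_erase hj]⟩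
  have h1 : (insert j (insert k T)).erase j = insert k T :=
    Finset.erase_insert (by simp [hjk, hjT])
  have h2 : (insert j (insert k T)).erase k = insert j T := by
    rw [Finset.insert_comm, Finset.erase_insert (by simp [hjk.symm, hkT])]
  rw [Finset.erase_right_comm, h1, h2, smul_smul, smul_smul, sgn_insert_self,
    Finset.insert_comm j k, sgn_insert_self, sgn_insert_self, sgn_insert_self]
  rw [Finset.erase_insert hjT, ← add_smul]
  rw [mul_comm (sgn R k (insert j T)), mul_comm (sgn R j (insert k T)),
    sgn_mul_sgn_insert hjk hjT hkT, add_neg_cancel, zero_smul]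

theorem contract_mul_wedge_self (j : ι) :
    contract R M j * wedge R M j + wedge R M j * contract R M j = 1 := by
  refine LinearMap.ext fun f => funext fun S => ?_
  simp only [LinearMap.add_apply, Module.End.mul_apply, Pi.add_apply, wedge_apply, contract_apply,
    Module.End.one_apply, Finset.mem_insert, Finset.mem_erase]
  by_cases hj : j ∈ S
  · simp [hj, smul_smul, sgn_erase_self, sgn_mul_self]
  · simp [hj, smul_smul, sgn_insert_self, sgn_mul_self]

theorem contract_mul_wedge_of_ne {j k : ι} (hjk : j ≠ k) :
    contract R M j * wedge R M k + wedge R M k * contract R M j = 0 := by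
  refine LinearMap.ext fun f => funext fun S => ?_
  simp only [LinearMap.add_apply, Module.End.mul_apply, Pi.add_apply, wedge_apply, contract_apply,
    LinearMap.zero_apply, Pi.zero_apply, Finset.mem_insert, Finset.mem_erase, ne_eq, hjk, hjk.symm,
    false_or, not_false_eq_true, true_and]
  by_cases hj : j ∈ S <;> by_cases hk : k ∈ S <;> simp only [hj, hk, if_true, if_false, smul_zero,
    add_zero]
  obtain ⟨T, hkT, rfl⟩ : ∃ T, k ∉ T ∧ S = insert k T :=
    ⟨S.erase k, by simp, (Finset.insert_erase hk).symm⟩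
  have hjT : j ∉ T := fun h => hj (Finset.mem_insert_of_mem h)
  have h2 : (insert j (insert k T)).erase k = insert j T := by
    rw [Finset.insert_comm, Finset.erase_insert (by simp [hjk.symm, hkT])]
  rw [Finset.erase_insert hkT, h2, smul_smul, smul_smul, Finset.insert_comm, sgn_insert_self,
    sgn_insert_self, ← add_smul, sgn_insert hkT, sgn_insert hjT]
  rcases lt_or_gt_of_ne hjk with h | h
  · rw [if_neg h.not_gt, if_pos h]; convert zero_smul R _ using 2; ring
  · rw [if_pos h, if_neg h.not_gt]; convert zero_smul R _ using 2; ring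

variable [Fintype ι]

/-- The Koszul differential of the sequence `h` with coefficients in `M`. -/
noncomputable def diff (M : Type*) [AddCommGroup M] [Module R M] (h : ι → R) :
    Module.End R (Finset ι → M) := ∑ j, h j • contract R M j

/-- Exterior multiplication by the vector `c`. -/
noncomputable def vecWedge (M : Type*) [AddCommGroup M] [Module R M] (c : ι → R) :
    Module.End R (Finset ι → M) := ∑ j, c j • wedge R M j

theorem diff_mul_self (h : ι → R) : diff M h * diff M h = 0 :=
  sum_smul_mul_self _ contract_mul_self contract_anticomm h

theorem vecWedge_mul_self (h : ι → R) : vecWedge M h * vecWedge M h = 0 :=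
  sum_smul_mul_self _ wedge_mul_self wedge_anticomm h

theorem diff_diff (h : ι → R) (x : Finset ι → M) : diff M h (diff M h x) = 0 :=
  LinearMap.congr_fun (diff_mul_self h) x

theorem diff_anticomm (h h' : ι → R) (x : Finset ι → M) :
    diff M h (diff M h' x) = -diff M h' (diff M h x) := by
  have := sum_smul_anticomm (E := Module.End R (Finset ι → M)) (contract R M) (contract R M)
    (fun _ _ => 0) (by simp [contract_anticomm]) h h'
  simp only [mul_zero, Finset.sum_const_zero, map_zero] at this
  exact eq_neg_of_add_eq_zero_left (LinearMap.congr_fun this x)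

/-- Wedging with `c` is a homotopy for multiplication by `∑ c j * h j`; if `c` is a relation among
the `h j`, it anticommutes with the differential. -/
theorem diff_vecWedge (h c : ι → R) (x : Finset ι → M) :
    diff M h (vecWedge M c x) = (∑ j, c j * h j) • x - vecWedge M c (diff M h x) := by
  have := sum_smul_anticomm (E := Module.End R (Finset ι → M)) (contract R M) (wedge R M)
    (fun j k => if j = k then 1 else 0) (by
      intro j k
      split_ifs with h
      · subst h; rw [contract_mul_wedge_self, map_one]
      · rw [contract_mul_wedge_of_ne h, map_zero]) h c
  rw [eq_sub_iff_add_eq]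
  refine (LinearMap.congr_fun this x).trans ?_
  simp [mul_comm, Finset.sum_smul, smul_smul]

theorem diff_single (j : ι) : diff M (Pi.single j (1 : R)) = contract R M j := by
  simp [diff, Pi.single_apply]

end FinsetKoszul

/-! ### Koszul homology and regular sequences -/

namespace FinsetKoszul

open RingTheory.Sequence Pointwise

variable {R : Type*} [CommRing R] {ι : Type*} {M N : Type*} [AddCommGroup M]
  [Module R M] [AddCommGroup N] [Module R N]

/-- The part of exterior degree `i` of the Koszul complex on the indices in `U`. -/
def chains (R M : Type*) [CommRing R] [AddCommGroup M] [Module R M] (U : Finset ι) (i : ℕ) :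
    Submodule R (Finset ι → M) where
  carrier := {f | ∀ S, f S ≠ 0 → S ⊆ U ∧ S.card = i}
  zero_mem' S h := absurd rfl h
  add_mem' {f g} hf hg S h := by
    by_cases h' : f S = 0
    · exact hg S fun h'' => h (by simp [h', h''])
    · exact hf S h'
  smul_mem' c f hf S h := hf S fun h' => h (by simp [h'])

theorem mem_chains {U : Finset ι} {i : ℕ} {f : Finset ι → M} :
    f ∈ chains R M U i ↔ ∀ S, f S ≠ 0 → S ⊆ U ∧ S.card = i := Iff.rfl

theorem mem_chains_univ [Fintype ι] {i : ℕ} {f : Finset ι → M} :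
    f ∈ chains R M Finset.univ i ↔ ∀ S, f S ≠ 0 → S.card = i := by
  simp [mem_chains]

theorem eq_zero_of_card_lt {U : Finset ι} {i : ℕ} (hi : U.card < i) {f : Finset ι → M}
    (hf : f ∈ chains R M U i) : f = 0 := by
  funext S
  by_contra h
  obtain ⟨h1, rfl⟩ := hf S h
  exact (Finset.card_le_card h1).not_gt hi

theorem comp_mem_chains (φ : M →ₗ[R] N) {U : Finset ι} {i : ℕ} {f : Finset ι → M}
    (hf : f ∈ chains R M U i) : φ.compLeft (Finset ι) f ∈ chains R N U i :=
  fun S h => hf S fun h' => h (by simp [h'])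

theorem exists_lift_chains {φ : M →ₗ[R] N} (hφ : Function.Surjective φ) {U : Finset ι} {i : ℕ}
    {f : Finset ι → N} (hf : f ∈ chains R N U i) :
    ∃ g ∈ chains R M U i, φ.compLeft (Finset ι) g = f := by
  classical
  choose σ hσ using hφ
  -- The value `0` where `f` vanishes keeps the support, so the lift has the same degree and the
  -- same index set.
  refine ⟨fun S => if f S = 0 then 0 else σ (f S), fun S h => hf S fun h' => h (by simp [h']), ?_⟩
  funext S
  by_cases h : f S = 0 <;> simp [h, hσ]

theorem exists_smul_of_mkQ_eq_zero {a : R} {U : Finset ι} {i : ℕ} {f : Finset ι → M}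
    (hf : f ∈ chains R M U i)
    (h0 : (Submodule.mkQ (a • (⊤ : Submodule R M))).compLeft (Finset ι) f = 0) :
    ∃ g ∈ chains R M U i, f = a • g := by
  classical
  have H : ∀ S, ∃ g, f S = a • g := fun S => by
    have := congrFun h0 S
    simp only [LinearMap.compLeft_apply, Function.comp_apply, Submodule.mkQ_apply,
      Pi.zero_apply, Submodule.Quotient.mk_eq_zero, Submodule.mem_smul_pointwise_iff_exists] at this
    obtain ⟨b, -, hb⟩ := this
    exact ⟨b, hb.symm⟩
  choose g hg using H
  refine ⟨fun S => if f S = 0 then 0 else g S, fun S h => hf S fun h' => h (by simp [h']), ?_⟩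
  funext S
  by_cases h : f S = 0
  · simp [h]
  · simp [h, ← hg]

theorem mkQ_comp_smul (a : R) (f : Finset ι → M) :
    (Submodule.mkQ (a • (⊤ : Submodule R M))).compLeft (Finset ι) (a • f) = 0 := by
  funext S
  simp only [LinearMap.compLeft_apply, Function.comp_apply, Submodule.mkQ_apply,
    Pi.zero_apply, Submodule.Quotient.mk_eq_zero, Pi.smul_apply]
  exact Submodule.smul_mem_pointwise_smul _ _ _ trivial

theorem smul_fun_injective {a : R} (ha : IsSMulRegular M a) {f g : Finset ι → M}
    (h : a • f = a • g) : f = g :=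
  funext fun S => ha (congrFun h S)

variable [LinearOrder ι]

theorem contract_mem_chains (j : ι) {U : Finset ι} {i : ℕ} {f : Finset ι → M}
    (hf : f ∈ chains R M U (i + 1)) : contract R M j f ∈ chains R M U i := by
  intro S h
  rw [contract_apply] at h
  split_ifs at h with hj
  · exact absurd rfl h
  obtain ⟨h1, h2⟩ := hf (insert j S) fun h' => h (by simp [h'])
  rw [Finset.card_insert_of_notMem hj] at h2
  exact ⟨(Finset.subset_insert _ _).trans h1, by omega⟩

theorem wedge_mem_chains {j : ι} {U : Finset ι} (hj : j ∈ U) {i : ℕ} {f : Finset ι → M}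
    (hf : f ∈ chains R M U i) : wedge R M j f ∈ chains R M U (i + 1) := by
  intro S h
  rw [wedge_apply] at h
  split_ifs at h with hjS
  · obtain ⟨h1, h2⟩ := hf (S.erase j) fun h' => h (by simp [h'])
    rw [Finset.card_erase_of_mem hjS] at h2
    have := Finset.card_pos.2 ⟨j, hjS⟩
    refine ⟨fun k hk => ?_, by omega⟩
    rcases eq_or_ne k j with rfl | hkj
    · exact hj
    · exact h1 (Finset.mem_erase.2 ⟨hkj, hk⟩)
  · exact absurd rfl h

variable [Fintype ι]

theorem diff_apply (h : ι → R) (f : Finset ι → M) :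
    diff M h f = ∑ j, h j • contract R M j f := by
  simp [diff]

theorem vecWedge_apply (c : ι → R) (f : Finset ι → M) :
    vecWedge M c f = ∑ j, c j • wedge R M j f := by
  simp [vecWedge]

theorem diff_mem_chains (h : ι → R) {U : Finset ι} {i : ℕ} {f : Finset ι → M}
    (hf : f ∈ chains R M U (i + 1)) : diff M h f ∈ chains R M U i := by
  rw [diff_apply]
  exact Submodule.sum_mem _ fun j _ => Submodule.smul_mem _ _ (contract_mem_chains j hf)

theorem vecWedge_mem_chains {c : ι → R} {U : Finset ι} (hc : ∀ j ∉ U, c j = 0) {i : ℕ}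
    {f : Finset ι → M} (hf : f ∈ chains R M U i) : vecWedge M c f ∈ chains R M U (i + 1) := by
  rw [vecWedge_apply]
  refine Submodule.sum_mem _ fun j _ => ?_
  by_cases hj : j ∈ U
  · exact Submodule.smul_mem _ _ (wedge_mem_chains hj hf)
  · rw [hc j hj, zero_smul]; exact zero_mem _

theorem diff_comp (φ : M →ₗ[R] N) (h : ι → R) (f : Finset ι → M) :
    diff N h (φ.compLeft (Finset ι) f) = φ.compLeft (Finset ι) (diff M h f) := by
  rw [diff_apply, diff_apply, map_sum]
  refine Finset.sum_congr rfl fun j _ => ?_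
  rw [map_smul]
  congr 1
  funext S
  simp only [contract_apply, LinearMap.compLeft_apply, Function.comp_apply]
  split_ifs <;> simp

theorem exists_coeff_of_mem_span {h : ι → R} {U : Finset ι} {a : R}
    (ha : a ∈ Ideal.span (h '' U)) : ∃ c : ι → R, (∀ j ∉ U, c j = 0) ∧ ∑ j, c j * h j = a := by
  obtain ⟨c, hc⟩ := (Submodule.mem_span_image_finset_iff_exists_fun' (R := R)).1 ha
  refine ⟨fun j => if j ∈ U then c j else 0, fun j hj => if_neg hj, ?_⟩
  rw [← hc]
  simp [ite_mul, Finset.sum_ite_mem]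

/-- A Koszul cycle multiplied by a power of `s` is a boundary, in degrees above the number of
generators minus the length of a weakly regular sequence lying, up to multiplication by `s`, in
the ideal generated by the sequence. -/
theorem exists_diff_eq_pow_smul (h : ι → R) (U : Finset ι) (s : R) (as : List R) :
    ∀ (M : Type*) [AddCommGroup M] [Module R M], IsWeaklyRegular M as →
      (∀ a ∈ as, s * a ∈ Ideal.span (h '' U)) → ∀ (i : ℕ) (x : Finset ι → M),
      x ∈ chains R M U i → diff M h x = 0 → U.card < i + as.length →
      ∃ w ∈ chains R M U (i + 1), diff M h w = s ^ as.length • x := by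
  induction as with
  | nil =>
    intro M _ _ _ _ i x hx _ hi
    exact ⟨0, zero_mem _, by rw [eq_zero_of_card_lt hi hx]; simp⟩
  | cons a as ih =>
    intro M _ _ hreg hmem i x hx hdx hi
    rw [isWeaklyRegular_cons_iff] at hreg
    obtain ⟨c, hcU, hc⟩ := exists_coeff_of_mem_span (hmem a (by simp))
    -- As `x` is a cycle, `c ∧ x` has boundary `(s * a) • x`, so it is a cycle modulo `a`, one
    -- degree higher.
    have hdv : diff M h (vecWedge M c x) = a • s • x := by
      rw [diff_vecWedge, hc, hdx, map_zero, sub_zero, smul_smul, mul_comm]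
    have hv : vecWedge M c x ∈ chains R M U (i + 1) := vecWedge_mem_chains hcU hx
    set v := vecWedge M c x
    obtain ⟨w, hw, hdw⟩ := ih (QuotSMulTop a M) hreg.2 (fun b hb => hmem b (by simp [hb])) (i + 1)
      _ (comp_mem_chains (Submodule.mkQ _) hv) (by rw [diff_comp, hdv, mkQ_comp_smul])
      (by rw [List.length_cons] at hi; omega)
    obtain ⟨w, hw', rfl⟩ := exists_lift_chains (Submodule.mkQ_surjective _) hw
    rw [diff_comp, ← map_smul, ← sub_eq_zero, ← map_sub] at hdw
    obtain ⟨u, hu, hwu⟩ := exists_smul_of_mkQ_eq_zero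
      (Submodule.sub_mem _ (diff_mem_chains h hw') (Submodule.smul_mem _ _ hv)) hdw
    -- Apply the differential to `diff w - s ^ k • v = a • u` and cancel the nonzerodivisor `a`.
    refine ⟨-u, neg_mem hu, smul_fun_injective hreg.1 ?_⟩
    have := congrArg (diff M h) hwu
    rw [map_sub, diff_diff, map_smul, map_smul, hdv, zero_sub] at this
    rw [map_neg, smul_neg, ← this, neg_neg, List.length_cons, pow_succ]
    simp only [smul_smul]
    congr 1; ring

theorem exists_diff_eq {h : ι → R} {U : Finset ι} {as : List R} (hreg : IsWeaklyRegular M as)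
    (hmem : ∀ a ∈ as, a ∈ Ideal.span (h '' U)) {i : ℕ} {x : Finset ι → M}
    (hx : x ∈ chains R M U i) (hdx : diff M h x = 0) (hi : U.card < i + as.length) :
    ∃ w ∈ chains R M U (i + 1), diff M h w = x := by
  obtain ⟨w, hw, h'⟩ := exists_diff_eq_pow_smul h U 1 as M hreg (by simpa using hmem) i x hx hdx hi
  exact ⟨w, hw, by simpa using h'⟩

/-- If `as` is a weakly regular sequence in the ideal of `h` which stays weakly regular after
appending `y`, then `y` is a nonzerodivisor on the Koszul homology of codegree `as.length`. -/
theorem exists_diff_eq_of_smul (h : ι → R) (U : Finset ι) (y : R) (as : List R) :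
    ∀ (M : Type*) [AddCommGroup M] [Module R M], IsWeaklyRegular M (as ++ [y]) →
      (∀ a ∈ as, a ∈ Ideal.span (h '' U)) → ∀ (i : ℕ) (x w : Finset ι → M),
      x ∈ chains R M U i → diff M h x = 0 → U.card ≤ i + as.length →
      w ∈ chains R M U (i + 1) → diff M h w = y • x →
      ∃ w ∈ chains R M U (i + 1), diff M h w = x := by
  induction as with
  | nil =>
    intro M _ _ hreg _ i x w hx hdx hi hw hdw
    rw [List.nil_append, isWeaklyRegular_singleton_iff] at hreg
    -- There are no nonzero chains above degree `U.card`, so `y • x = 0`.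
    rw [eq_zero_of_card_lt (Nat.lt_succ_of_le hi) hw, map_zero] at hdw
    refine ⟨0, zero_mem _, smul_fun_injective hreg ?_⟩
    rw [map_zero, smul_zero, hdw]
  | cons a as ih =>
    intro M _ _ hreg hmem i x w hx hdx hi hw hdw
    have hreg' : IsWeaklyRegular M (a :: as) := (isWeaklyRegular_append_iff M _ _).1 hreg |>.1
    rw [List.cons_append, isWeaklyRegular_cons_iff] at hreg
    obtain ⟨c, hcU, hc⟩ := exists_coeff_of_mem_span (hmem a (by simp))
    have hdv : diff M h (vecWedge M c x) = a • x := by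
      rw [diff_vecWedge, hc, hdx, map_zero, sub_zero]
    have hv : vecWedge M c x ∈ chains R M U (i + 1) := vecWedge_mem_chains hcU hx
    set v := vecWedge M c x
    -- `y • v - a • w` is a cycle in a degree where the homology vanishes; hence `y • v` is a
    -- boundary modulo `a`, as the induction hypothesis requires.
    obtain ⟨w₁, hw₁, hdw₁⟩ := exists_diff_eq hreg' hmem (x := y • v - a • w)
      (Submodule.sub_mem _ (Submodule.smul_mem _ _ hv) (Submodule.smul_mem _ _ hw))
      (by rw [map_sub, map_smul, map_smul, hdv, hdw, smul_comm, sub_self])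
      (by rw [List.length_cons] at hi ⊢; omega)
    obtain ⟨w₂, hw₂, hdw₂⟩ := ih (QuotSMulTop a M) hreg.2 (fun b hb => hmem b (by simp [hb])) (i + 1)
      _ _ (comp_mem_chains (Submodule.mkQ _) hv) (by rw [diff_comp, hdv, mkQ_comp_smul])
      (by rw [List.length_cons] at hi; omega) (comp_mem_chains (Submodule.mkQ _) hw₁)
      (by rw [diff_comp, hdw₁, map_sub, mkQ_comp_smul, sub_zero, map_smul])
    obtain ⟨w₂, hw₂', rfl⟩ := exists_lift_chains (Submodule.mkQ_surjective _) hw₂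
    rw [diff_comp, ← sub_eq_zero, ← map_sub] at hdw₂
    obtain ⟨u, hu, hwu⟩ := exists_smul_of_mkQ_eq_zero
      (Submodule.sub_mem _ (diff_mem_chains h hw₂') hv) hdw₂
    refine ⟨-u, neg_mem hu, smul_fun_injective hreg.1 ?_⟩
    have := congrArg (diff M h) hwu
    rw [map_sub, diff_diff, map_smul, hdv, zero_sub] at this
    rw [map_neg, smul_neg, ← this, neg_neg]

/-- If the Koszul homology of `h` vanishes in codegrees at most the length of the weakly regular
sequence `as`, then no nonzero element of `M / (as) M` is killed by `h`. -/
theorem mem_of_smul_mem (h : ι → R) (as : List R) :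
    ∀ (M : Type*) [AddCommGroup M] [Module R M], IsWeaklyRegular M as →
      (∀ (i : ℕ) (x : Finset ι → M), x ∈ chains R M Finset.univ i → diff M h x = 0 →
        Fintype.card ι ≤ i + as.length →
        ∃ w ∈ chains R M Finset.univ (i + 1), diff M h w = x) →
      ∀ x : M, (∀ j, h j • x ∈ Ideal.ofList as • (⊤ : Submodule R M)) →
        x ∈ Ideal.ofList as • (⊤ : Submodule R M) := by
  induction as with
  | nil =>
    intro M _ _ _ hH x hx
    simp only [Ideal.ofList_nil, Submodule.bot_smul, Submodule.mem_bot] at hx ⊢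
    -- An element killed by every `h j` is a cycle in top degree, where the only boundary is zero.
    obtain ⟨w, hw, hdw⟩ := hH (Fintype.card ι) (Pi.single Finset.univ x)
      (mem_chains_univ.2 fun S hS => by
        by_cases h' : S = Finset.univ
        · rw [h', Finset.card_univ]
        · exact absurd (Pi.single_eq_of_ne h' _) hS)
      (by
        rw [diff_apply]
        refine Finset.sum_eq_zero fun j _ => funext fun S => ?_
        rw [Pi.smul_apply, contract_apply]
        split_ifs with hj
        · simp
        by_cases h' : insert j S = Finset.univ
        · rw [h', Pi.single_eq_same, smul_comm, hx, smul_zero, Pi.zero_apply]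
        · rw [Pi.single_eq_of_ne h', smul_zero, smul_zero, Pi.zero_apply])
      (by simp)
    rw [eq_zero_of_card_lt (by rw [Finset.card_univ]; exact Nat.lt_succ_self _) hw, map_zero] at hdw
    rw [← Pi.single_eq_same (M := fun _ => M) (Finset.univ : Finset ι) x, ← hdw, Pi.zero_apply]
  | cons a as ih =>
    intro M _ _ hreg hH x hx
    rw [isWeaklyRegular_cons_iff] at hreg
    have key : ∀ x : M, x ∈ Ideal.ofList (a :: as) • (⊤ : Submodule R M) ↔
        Submodule.mkQ (a • (⊤ : Submodule R M)) x ∈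
          Ideal.ofList as • (⊤ : Submodule R (QuotSMulTop a M)) := fun x => by
      rw [Ideal.ofList_cons_smul, ← Submodule.comap_map_mkQ, Submodule.mem_comap,
        Submodule.map_smul'', Submodule.map_top, Submodule.range_mkQ]
    rw [key]
    refine ih (QuotSMulTop a M) hreg.2 (fun i x hx' hdx hi => ?_) _ fun j => by
      rw [← map_smul, ← key]; exact hx j
    obtain ⟨x, hx, rfl⟩ := exists_lift_chains (Submodule.mkQ_surjective _) hx'
    cases i with
    | zero =>
      obtain ⟨w, hw, hdw⟩ := hH 0 x hx (by
        rw [diff_apply]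
        refine Finset.sum_eq_zero fun j _ => funext fun S => ?_
        rw [Pi.smul_apply, contract_apply]
        split_ifs with hj
        · simp
        · have : x (insert j S) = 0 := by
            by_contra h'
            exact Finset.insert_ne_empty j S (Finset.card_eq_zero.1 (hx _ h').2)
          simp [this]) (by rw [List.length_cons]; omega)
      exact ⟨_, comp_mem_chains (Submodule.mkQ _) hw, by rw [diff_comp, hdw]⟩
    | succ i =>
    rw [diff_comp] at hdx
    -- A cycle modulo `a` lifts to a cycle: if `diff x = a • u`, then `u` is a cycle because `a` is
    -- regular, so `u = diff v`, and `x - a • v` is the lift.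
    obtain ⟨u, hu, hxu⟩ := exists_smul_of_mkQ_eq_zero (diff_mem_chains h hx) hdx
    obtain ⟨v, hv, hdv⟩ := hH i u hu (smul_fun_injective hreg.1 (by
      rw [← map_smul, ← hxu, diff_diff, smul_zero])) (by rw [List.length_cons]; omega)
    obtain ⟨w, hw, hdw⟩ := hH (i + 1) (x - a • v)
      (Submodule.sub_mem _ hx (Submodule.smul_mem _ _ hv))
      (by rw [map_sub, map_smul, hdv, hxu, sub_self]) (by rw [List.length_cons]; omega)
    exact ⟨_, comp_mem_chains (Submodule.mkQ _) hw, by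
      rw [diff_comp, hdw, map_sub, mkQ_comp_smul, sub_zero]⟩

end FinsetKoszul

open RingTheory.Sequence in
/-- In a Cohen-Macaulay local ring, an element that the maximal ideal multiplies into the ideal of
a weakly regular sequence shorter than the dimension lies in that ideal. -/
theorem IsCohenMacaulayLocal.mem_of_mul_mem {L : Type*} [CommRing L] [IsNoetherianRing L]
    [IsLocalRing L] (hL : IsCohenMacaulayLocal L) {as : List L} (has : IsWeaklyRegular L as)
    (hlen : (as.length : WithBot ℕ∞) < ringKrullDim L) {x : L}
    (hx : ∀ y ∈ IsLocalRing.maximalIdeal L, y * x ∈ Ideal.ofList as) : x ∈ Ideal.ofList as := by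
  obtain ⟨rs, hrs, hreg, hdim⟩ := hL
  obtain ⟨N, g, hg⟩ := Submodule.fg_iff_exists_fin_generating_family.1
    (IsNoetherian.noetherian (IsLocalRing.maximalIdeal L))
  rw [← hdim] at hlen
  have hlen' : as.length < rs.length := by exact_mod_cast hlen
  -- The regular sequence `rs` makes the Koszul homology of generators of the maximal ideal vanish
  -- in every codegree below `dim L`, in particular up to `as.length`.
  have := FinsetKoszul.mem_of_smul_mem g as L has (fun i x hx hdx hi =>
    FinsetKoszul.exists_diff_eq hreg.toIsWeaklyRegular
      (fun a ha => by
        rw [Finset.coe_univ, Set.image_univ]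
        exact hg.ge (hrs a ha)) hx hdx (by rw [Finset.card_univ]; omega)) x (fun j => by
          rw [smul_eq_mul, smul_eq_mul, Ideal.mul_top]
          exact hx _ (hg.le (Submodule.subset_span ⟨j, rfl⟩)))
  rwa [smul_eq_mul, Ideal.mul_top] at this

open RingTheory.Sequence in
/-- A weakly regular sequence of a Cohen-Macaulay ring can be extended by an element of any ideal
whose height exceeds its length. -/
theorem IsCohenMacaulay.exists_isWeaklyRegular_append {A : Type*} [CommRing A]
    (hA : IsCohenMacaulay A) {as : List A} (has : IsWeaklyRegular A as) (J : Ideal A)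
    (hlen : (as.length : ℕ∞) < J.height) : ∃ y ∈ J, IsWeaklyRegular A (as ++ [y]) := by
  obtain ⟨hN, hloc⟩ := hA
  by_contra! H
  -- If no element of `J` is regular on `A / (as)`, prime avoidance puts `J` in an associated prime
  -- `p`. Then `A_p` has dimension greater than `as.length`, and the local lemma excludes that `p`
  -- be associated.
  have hsub : (J : Set A) ⊆
      ⋃ p ∈ associatedPrimes A (A ⧸ (Ideal.ofList as • ⊤ : Submodule A A)), (p : Set A) := by
    rw [biUnion_associatedPrimes_eq_compl_regular]
    intro y hy hy'
    refine H y hy ?_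
    rw [isWeaklyRegular_append_iff, isWeaklyRegular_singleton_iff]
    exact ⟨has, hy'⟩
  rw [Ideal.subset_union_prime_finite (associatedPrimes.finite _ _) ⊥ ⊥
    fun p hp _ _ => hp.1] at hsub
  obtain ⟨p, hp, hJp⟩ := hsub
  rw [AssociatedPrimes.mem_iff, isAssociatedPrime_iff] at hp
  obtain ⟨hpp, x, hpx⟩ := hp
  obtain ⟨x, rfl⟩ := Submodule.mkQ_surjective _ x
  have hmem : ∀ y, y ∈ p ↔ y * x ∈ Ideal.ofList as := fun y => by
    rw [hpx, Submodule.mem_colon_singleton, Submodule.mem_bot, ← map_smul, Submodule.mkQ_apply,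
      Submodule.Quotient.mk_eq_zero, smul_eq_mul, smul_eq_mul, Ideal.mul_top]
  have hflat := IsWeaklyRegular.of_isLocalization (Localization.AtPrime p) p.primeCompl has
  have key := IsCohenMacaulayLocal.mem_of_mul_mem (hloc p) hflat
    (x := algebraMap A (Localization.AtPrime p) x) (by
      rw [IsLocalization.AtPrime.ringKrullDim_eq_height p, List.length_map]
      exact_mod_cast hlen.trans_le (Ideal.height_mono hJp)) (fun y hy => by
        rw [← Localization.AtPrime.map_eq_maximalIdeal] at hy
        have h1 : p * Ideal.span {x} ≤ Ideal.ofList as := by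
          rw [Ideal.mul_le]
          intro r hr s hs
          obtain ⟨c, rfl⟩ := Ideal.mem_span_singleton'.1 hs
          rw [mul_left_comm]
          exact Ideal.mul_mem_left _ _ ((hmem r).1 hr)
        have h2 := Ideal.map_mono (f := algebraMap A (Localization.AtPrime p)) h1
        rw [Ideal.map_mul, Ideal.map_ofList] at h2
        exact h2 (Ideal.mul_mem_mul hy (Ideal.mem_map_of_mem _ (Ideal.mem_span_singleton_self x))))
  rw [← Ideal.map_ofList, IsLocalization.algebraMap_mem_map_algebraMap_iff p.primeCompl] at key
  obtain ⟨s, hs, hsx⟩ := key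
  exact hs ((hmem s).2 hsx)

open RingTheory.Sequence in
theorem IsCohenMacaulay.exists_isWeaklyRegular {A : Type*} [CommRing A]
    (hA : IsCohenMacaulay A) (J : Ideal A) (n : ℕ) (hn : (n : ℕ∞) ≤ J.height) :
    ∃ as : List A, as.length = n ∧ (∀ a ∈ as, a ∈ J) ∧ IsWeaklyRegular A as := by
  induction n with
  | zero => exact ⟨[], rfl, by simp, .nil A A⟩
  | succ n ih =>
    have hn' : (n : ℕ∞) < J.height :=
      (Nat.cast_lt.2 (Nat.lt_succ_self n)).trans_le hn
    obtain ⟨as, hlen, hmem, has⟩ := ih hn'.le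
    obtain ⟨y, hy, hreg⟩ := hA.exists_isWeaklyRegular_append has J (hlen ▸ hn')
    refine ⟨as ++ [y], by simp [hlen], fun a ha => ?_, hreg⟩
    rcases List.mem_append.1 ha with h | h
    · exact hmem a h
    · rw [List.mem_singleton.1 h]; exact hy

/-! ### Heights of primes and homogeneous cores -/

section Graded

variable {A σ : Type*} [CommRing A] [SetLike σ A] [AddSubmonoidClass σ A]
  (𝒜 : ℕ → σ) [GradedRing 𝒜]

theorem GradedRing.proj_mem (i : ℕ) (x : A) : GradedRing.proj 𝒜 i x ∈ 𝒜 i :=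
  (DirectSum.decompose 𝒜 x i).2

theorem GradedRing.proj_mul_of_left_mem {i : ℕ} {a : A} (ha : a ∈ 𝒜 i) (n : ℕ) (b : A) :
    GradedRing.proj 𝒜 n (a * b) = if i ≤ n then a * GradedRing.proj 𝒜 (n - i) b else 0 :=
  DirectSum.coe_decompose_mul_of_left_mem 𝒜 n ha

theorem GradedRing.exists_forall_proj_eq_zero (x : A) :
    ∃ l, ∀ i, l < i → GradedRing.proj 𝒜 i x = 0 := by
  classical
  refine ⟨(DirectSum.decompose 𝒜 x).support.sup id, fun i hi => ?_⟩
  by_contra h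
  exact (Finset.le_sup (f := id) ((GradedRing.mem_support_iff 𝒜 x i).2 h)).not_gt hi

variable {𝒜}

/-- Pseudo-division modulo a homogeneous prime `p` in a prime `P` whose homogeneous elements all
lie in `p`: up to multiplication by elements outside `P`, the ideal `P` is principal modulo `p`. -/
theorem Ideal.IsPrime.exists_principal_mod_of_homogeneous {p P : Ideal A} (hp : p.IsHomogeneous 𝒜)
    (hP : P.IsPrime) (hlt : p < P) (hhom : ∀ i, ∀ a ∈ 𝒜 i, a ∈ P → a ∈ p) :
    ∃ f ∈ P, ∀ x ∈ P, ∃ u ∉ P, ∃ g, u * x - g * f ∈ p := by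
  classical
  have mem_of : ∀ x, (∀ i, GradedRing.proj 𝒜 i x ∈ p) → x ∈ p := fun x hx => hp.mem_iff.2 hx
  -- The divisor `f` is chosen in `P \ p` so that the interval of degrees containing all its
  -- components outside `p` is as short as possible.
  have hex : ∃ l, ∃ b, ∃ f ∈ P, f ∉ p ∧ ∀ i, ¬(b ≤ i ∧ i ≤ b + l) → GradedRing.proj 𝒜 i f ∈ p := by
    obtain ⟨f, hf, hfp⟩ := SetLike.exists_of_lt hlt
    obtain ⟨l, hl⟩ := GradedRing.exists_forall_proj_eq_zero 𝒜 f
    exact ⟨l, 0, f, hf, hfp, fun i hi => by rw [hl i (by omega)]; exact zero_mem _⟩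
  have hmin := fun m (hm : m < Nat.find hex) => Nat.find_min hex hm
  obtain ⟨a, f, hf, hfp, hfW⟩ := Nat.find_spec hex
  set l := Nat.find hex
  have htop : GradedRing.proj 𝒜 (a + l) f ∉ p := by
    intro htop
    have hW : ∀ i, ¬(a ≤ i ∧ i < a + l) → GradedRing.proj 𝒜 i f ∈ p := fun i hi => by
      by_cases h : i = a + l
      · rwa [h]
      · exact hfW i (by omega)
    by_cases hl : l = 0
    · exact hfp (mem_of f fun i => hW i (by omega))
    · exact hmin (l - 1) (by omega) ⟨a, f, hf, hfp, fun i hi => hW i (by omega)⟩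
  have hF := GradedRing.proj_mem 𝒜 (a + l) f
  set F := GradedRing.proj 𝒜 (a + l) f
  have hFP : F ∉ P := fun h => htop (hhom _ _ hF h)
  refine ⟨f, hf, ?_⟩
  suffices H : ∀ m b, ∀ x ∈ P, (∀ i, ¬(b ≤ i ∧ i ≤ b + m) → GradedRing.proj 𝒜 i x ∈ p) →
      ∃ u ∉ P, ∃ g, u * x - g * f ∈ p by
    intro x hx
    obtain ⟨m, hm⟩ := GradedRing.exists_forall_proj_eq_zero 𝒜 x
    exact H m 0 x hx fun i hi => by rw [hm i (by omega)]; exact zero_mem _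
  intro m
  induction m using Nat.strong_induction_on with
  | _ m ih =>
  intro b x hx hxW
  by_cases hxp : x ∈ p
  · exact ⟨1, fun h => hP.ne_top ((Ideal.eq_top_iff_one _).2 h), 0, by simpa using hxp⟩
  have hlm : l ≤ m := by
    by_contra! h
    exact hmin m h ⟨b, x, hx, hxp, hxW⟩
  have hX := GradedRing.proj_mem 𝒜 (b + m) x
  obtain ⟨X, hXeq⟩ : ∃ X, X = GradedRing.proj 𝒜 (b + m) x := ⟨_, rfl⟩
  rw [← hXeq] at hX
  -- Cross-multiplying by the top components cancels the top degree: the interval for `F * x - X *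
  -- f` is shorter than that for `x`, while `F ∉ P`.
  have hr : ∀ i, ¬(a + l + b ≤ i ∧ i < a + l + b + m) →
      GradedRing.proj 𝒜 i (F * x - X * f) ∈ p := by
    intro i hi
    rw [map_sub, GradedRing.proj_mul_of_left_mem 𝒜 hF, GradedRing.proj_mul_of_left_mem 𝒜 hX]
    by_cases hi' : i = a + l + b + m
    · rw [if_pos (by omega), if_pos (by omega), show i - (a + l) = b + m by omega,
        show i - (b + m) = a + l by omega, ← hXeq, mul_comm X, sub_self]
      exact zero_mem _
    · refine sub_mem ?_ ?_
      · split_ifs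
        · exact Ideal.mul_mem_left _ _ (hxW _ (by omega))
        · exact zero_mem _
      · split_ifs
        · exact Ideal.mul_mem_left _ _ (hfW _ (by omega))
        · exact zero_mem _
  by_cases hm : m = 0
  · exact ⟨F, hFP, X, mem_of _ fun i => hr i (by omega)⟩
  obtain ⟨u, hu, g, hg⟩ := ih (m - 1) (by omega) (a + l + b) (F * x - X * f)
    (sub_mem (P.mul_mem_left _ hx) (P.mul_mem_left _ hf)) fun i hi => hr i (by omega)
  refine ⟨u * F, fun h => (hP.mem_or_mem h).elim hu hFP, g + u * X, ?_⟩
  convert hg using 1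
  ring

/-- There is no prime strictly between a prime and its homogeneous core. -/
theorem Ideal.IsPrime.not_lt_of_homogeneousCore_lt [IsNoetherianRing A] {P q : Ideal A}
    (hP : P.IsPrime) (hq : q.IsPrime) (hPq : (P.homogeneousCore 𝒜).toIdeal < q) : ¬q < P := by
  intro hqP
  have hp : (P.homogeneousCore 𝒜).toIdeal.IsPrime := hP.homogeneousCore
  obtain ⟨f, hf, H⟩ := exists_principal_mod_of_homogeneous (𝒜 := 𝒜)
    (P.homogeneousCore 𝒜).isHomogeneous hP (hPq.trans hqP)
    fun i a ha haP => Ideal.mem_homogeneousCore_of_homogeneous_of_mem ⟨i, ha⟩ haP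
  -- The intermediate prime can be taken to contain `f`; since `P` is generated by `f` modulo the
  -- core up to multipliers outside `P`, it then contains all of `P`.
  obtain ⟨q', hfq', h1, h2⟩ := PrimeSpectrum.exist_mem_one_of_mem_two
    (p₀ := ⟨_, hp⟩) (p₁ := ⟨q, hq⟩) (p₂ := ⟨P, hP⟩) hPq hqP hf
  refine h2.not_ge fun x hx => ?_
  obtain ⟨u, hu, g, hg⟩ := H x hx
  have : u * x ∈ q'.asIdeal := by
    rw [← sub_add_cancel (u * x) (g * f)]
    exact add_mem (h1.le hg) (Ideal.mul_mem_left _ _ hfq')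
  exact (q'.2.mem_or_mem this).resolve_left fun h => hu (h2.le h)

/-- For a prime `q < P`, compare cores. If they differ, the induction hypothesis gives `ht q ≤ ht q*
+ 1 ≤ ht P*`. If they agree, `q` equals `P*`, since no prime lies strictly between `P*` and `P`. -/
theorem Ideal.IsPrime.height_le_height_homogeneousCore_add_one [IsNoetherianRing A] (P : Ideal A)
    (hP : P.IsPrime) : P.height ≤ (P.homogeneousCore 𝒜).toIdeal.height + 1 := by
  obtain ⟨n, hn⟩ : ∃ n : ℕ, P.height ≤ n := by
    obtain ⟨n, hn⟩ := ENat.ne_top_iff_exists.1 (Ideal.height_ne_top_of_isPrime (I := P))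
    exact ⟨n, hn.ge⟩
  induction n using Nat.strong_induction_on generalizing P with
  | _ n ih =>
  have hp : (P.homogeneousCore 𝒜).toIdeal.IsPrime := hP.homogeneousCore
  obtain ⟨k, hk⟩ := ENat.ne_top_iff_exists.1
    (Ideal.height_ne_top_of_isPrime (I := (P.homogeneousCore 𝒜).toIdeal))
  rw [← hk]
  rw [show ((k : ℕ∞) + 1) = ((k + 1 : ℕ) : ℕ∞) by simp, Ideal.height_le_iff]
  intro q hq hqP
  have hqn : q.height < n := (Ideal.height_le_iff.1 hn) q hq hqP
  obtain ⟨j, hj⟩ := ENat.ne_top_iff_exists.1 (Ideal.height_ne_top_of_isPrime (I := q))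
  have hjn : j < n := by rw [← hj] at hqn; exact_mod_cast hqn
  have hqp : (q.homogeneousCore 𝒜).toIdeal.IsPrime := hq.homogeneousCore
  have hle : (q.homogeneousCore 𝒜).toIdeal ≤ (P.homogeneousCore 𝒜).toIdeal :=
    Ideal.homogeneousCore_mono 𝒜 hqP.le
  suffices hqk : q.height ≤ k by
    exact hqk.trans_lt (by exact_mod_cast Nat.lt_succ_self k)
  rcases hle.lt_or_eq with h | h
  · rw [hk]
    exact (ih j hjn q hq hj.ge).trans (Ideal.height_add_one_le_of_lt_of_isPrime h)
  · rcases (Ideal.toIdeal_homogeneousCore_le 𝒜 q).lt_or_eq with h' | h'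
    · exact absurd hqP (hP.not_lt_of_homogeneousCore_lt (𝒜 := 𝒜) hq (h ▸ h'))
    · rw [← h', h, hk]

end Graded

section ConnectedGraded

variable {K A : Type*} [Field K] [CommRing A] [Algebra K A]
  (𝒜 : ℕ → Submodule K A) [GradedAlgebra 𝒜]

theorem HomogeneousIdeal.irrelevant_isMaximal [Nontrivial A]
    (hA₀ : ∀ a ∈ 𝒜 0, ∃ c : K, algebraMap K A c = a) :
    (HomogeneousIdeal.irrelevant 𝒜).toIdeal.IsMaximal := by
  refine Ideal.isMaximal_iff.2 ⟨fun h => ?_, fun J x _ hx hxJ => ?_⟩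
  · have h1 : GradedRing.proj 𝒜 0 (1 : A) = 0 := (HomogeneousIdeal.mem_irrelevant_iff 𝒜 1).1 h
    have h2 : GradedRing.proj 𝒜 0 (1 : A) = 1 :=
      DirectSum.decompose_of_mem_same 𝒜 SetLike.GradedOne.one_mem
    exact one_ne_zero (h2.symm.trans h1)
  · obtain ⟨c, hc⟩ := hA₀ _ (GradedRing.proj_mem 𝒜 0 x)
    have hc0 : c ≠ 0 := by
      rintro rfl
      exact hx ((HomogeneousIdeal.mem_irrelevant_iff 𝒜 x).2 (by rw [← hc, map_zero]))
    have h1 : x - algebraMap K A c ∈ J := ‹_ ≤ J› ((HomogeneousIdeal.mem_irrelevant_iff 𝒜 _).2 (by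
      rw [map_sub, hc, sub_eq_zero]
      exact (DirectSum.decompose_of_mem_same 𝒜 (GradedRing.proj_mem 𝒜 0 x)).symm))
    have h2 : algebraMap K A c ∈ J := by simpa using sub_mem hxJ h1
    have h3 := J.mul_mem_left (algebraMap K A c⁻¹) h2
    rwa [← map_mul, inv_mul_cancel₀ hc0, map_one] at h3

theorem Ideal.homogeneousCore_le_irrelevant
    (hA₀ : ∀ a ∈ 𝒜 0, ∃ c : K, algebraMap K A c = a) {P : Ideal A} (hP : P ≠ ⊤) :
    (P.homogeneousCore 𝒜).toIdeal ≤ (HomogeneousIdeal.irrelevant 𝒜).toIdeal := by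
  intro x hx
  refine (HomogeneousIdeal.mem_irrelevant_iff 𝒜 x).2 ?_
  have h0 : GradedRing.proj 𝒜 0 x ∈ P :=
    Ideal.toIdeal_homogeneousCore_le 𝒜 P ((P.homogeneousCore 𝒜).isHomogeneous 0 hx)
  obtain ⟨c, hc⟩ := hA₀ _ (GradedRing.proj_mem 𝒜 0 x)
  by_contra hne
  have hc0 : c ≠ 0 := by rintro rfl; exact hne (by rw [← hc, map_zero])
  refine hP ((Ideal.eq_top_iff_one _).2 ?_)
  rw [← hc] at h0
  have h3 := P.mul_mem_left (algebraMap K A c⁻¹) h0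
  rwa [← map_mul, inv_mul_cancel₀ hc0, map_one] at h3

/-- The irrelevant maximal ideal of a Noetherian connected graded algebra has maximal height. -/
theorem ringKrullDim_le_height_irrelevant [IsNoetherianRing A]
    (hA₀ : ∀ a ∈ 𝒜 0, ∃ c : K, algebraMap K A c = a) :
    ringKrullDim A ≤ (HomogeneousIdeal.irrelevant 𝒜).toIdeal.height := by
  rw [ringKrullDim_le_iff_height_le]
  intro P hP
  have : Nontrivial A := ⟨0, 1, fun h => hP.ne_top ((Ideal.eq_top_iff_one _).2
    (h ▸ zero_mem _))⟩
  have hmax := HomogeneousIdeal.irrelevant_isMaximal 𝒜 hA₀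
  have hcore : (P.homogeneousCore 𝒜).toIdeal.IsPrime := hP.homogeneousCore
  rw [WithBot.coe_le_coe]
  rcases (Ideal.homogeneousCore_le_irrelevant 𝒜 hA₀ hP.ne_top).lt_or_eq with h | h
  · have := hmax.isPrime
    exact (hP.height_le_height_homogeneousCore_add_one (𝒜 := 𝒜)).trans
      (Ideal.height_add_one_le_of_lt_of_isPrime h)
  · rw [hmax.eq_of_le hP.ne_top (h ▸ Ideal.toIdeal_homogeneousCore_le 𝒜 P)]

end ConnectedGraded

/-! ### Redundant generators and the irrelevant ideal -/

section LocallyGenerated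

/-- Over a local ring, if an ideal generated by a finite family can be generated by fewer
elements, then some member of the family is redundant. -/
theorem IsLocalRing.exists_mem_span_image_erase {L : Type*} [CommRing L] [IsLocalRing L] {n : ℕ}
    (h : Fin (n + 1) → L) (f : Fin n → L)
    (hf : Ideal.span (Set.range h) = Ideal.span (Set.range f)) :
    ∃ j, h j ∈ Ideal.span (h '' (Finset.univ.erase j : Finset (Fin (n + 1)))) := by
  have h1 : ∀ k, ∃ c : Fin (n + 1) → L, ∑ i, c i • h i = f k := fun k =>
    (Submodule.mem_span_range_iff_exists_fun L).1 (hf.ge (Ideal.subset_span ⟨k, rfl⟩))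
  have h2 : ∀ j, ∃ c : Fin n → L, ∑ k, c k • f k = h j := fun j =>
    (Submodule.mem_span_range_iff_exists_fun L).1 (hf.le (Ideal.subset_span ⟨j, rfl⟩))
  choose P hP using h1
  choose B hB using h2
  -- From `h = B f` and `f = P h` follows `(1 - B P) h = 0`; a unit entry in column `i` makes `h i`
  -- redundant.
  have hrel : ∀ j, ∑ i, ((1 : Matrix (Fin (n + 1)) (Fin (n + 1)) L) - Matrix.of B * Matrix.of P) j i * h i = 0 := by
    intro j
    have : ∑ i, (Matrix.of B * Matrix.of P) j i * h i = h j := by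
      rw [← hB j]
      simp_rw [← hP, Matrix.mul_apply, Finset.sum_mul, Finset.smul_sum, Matrix.of_apply,
        smul_eq_mul, mul_assoc]
      exact Finset.sum_comm
    simp only [Matrix.sub_apply, sub_mul, Finset.sum_sub_distrib, this, Matrix.one_apply]
    simp
  obtain ⟨j, i, hu⟩ : ∃ j i, IsUnit (((1 : Matrix (Fin (n + 1)) (Fin (n + 1)) L) - Matrix.of B * Matrix.of P) j i) := by
    -- Otherwise `B P` reduces to the identity of size `n + 1` over the residue field, although its
    -- rank is at most `n`.
    by_contra! H
    have h1 : (Matrix.of B).map (IsLocalRing.residue L) * (Matrix.of P).map (IsLocalRing.residue L)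
        = 1 := by
      rw [← Matrix.map_mul]
      ext j i
      have := (IsLocalRing.residue_eq_zero_iff _).2 ((IsLocalRing.mem_maximalIdeal _).2 (H j i))
      rw [Matrix.sub_apply, map_sub, sub_eq_zero] at this
      rw [Matrix.map_apply, ← this, Matrix.one_apply, Matrix.one_apply]
      split_ifs <;> simp
    have h2 := Matrix.rank_mul_le_left ((Matrix.of B).map (IsLocalRing.residue L))
      ((Matrix.of P).map (IsLocalRing.residue L))
    rw [h1, Matrix.rank_one, Fintype.card_fin] at h2
    have h3 := Matrix.rank_le_width ((Matrix.of B).map (IsLocalRing.residue L))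
    omega
  refine ⟨i, ?_⟩
  have h3 := hrel j
  rw [← Finset.add_sum_erase _ _ (Finset.mem_univ i)] at h3
  rw [← Ideal.unit_mul_mem_iff_mem _ hu, eq_neg_of_add_eq_zero_left h3]
  exact neg_mem (Ideal.sum_mem _ fun k hk => Ideal.mul_mem_left _ _
    (Ideal.subset_span ⟨k, hk, rfl⟩))

/-- If `Proj (A / I)` is locally defined by `n` equations, then up to radical the irrelevant ideal
is generated by multipliers that make one of the `n + 1` generators of `I` redundant. -/
theorem ProjLocallyDefinedBy.irrelevant_le_radical {A σ : Type*} [CommRing A] [SetLike σ A]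
    [AddSubmonoidClass σ A] (𝒜 : ℕ → σ) [GradedRing 𝒜] {n d : ℕ} (hn : n ≠ 0)
    (h : Fin (n + 1) → A) (hdeg : ∀ i, h i ∈ 𝒜 d)
    (hX : ProjLocallyDefinedBy 𝒜 (Ideal.span (Set.range h)) n) :
    (HomogeneousIdeal.irrelevant 𝒜).toIdeal ≤ (Ideal.span {s : A | ∃ j, s * h j ∈
      Ideal.span (h '' (Finset.univ.erase j : Finset (Fin (n + 1))))}).radical := by
  set Q := Ideal.span {s : A | ∃ j, s * h j ∈
      Ideal.span (h '' (Finset.univ.erase j : Finset (Fin (n + 1))))} with hQ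
  rw [Ideal.radical_eq_sInf]
  refine le_sInf ?_
  rintro P ⟨hQP, hP⟩
  by_contra hirr
  let x : ProjectiveSpectrum 𝒜 := ⟨P.homogeneousCore 𝒜, hP.homogeneousCore, fun hle =>
    hirr (le_trans hle (Ideal.toIdeal_homogeneousCore_le 𝒜 P))⟩
  have hxP : x.asHomogeneousIdeal.toIdeal.IsPrime := x.isPrime
  have hIP : Ideal.span (Set.range h) ≤ x.asHomogeneousIdeal.toIdeal := by
    rw [Ideal.span_le]
    rintro _ ⟨i, rfl⟩
    refine Ideal.mem_homogeneousCore_of_homogeneous_of_mem ⟨d, hdeg i⟩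
      (hQP (Ideal.subset_span ?_))
    -- Each `h i` is itself such a multiplier, for any `j ≠ i`; this needs `n ≠ 0`.
    obtain ⟨j, hj⟩ : ∃ j : Fin (n + 1), j ≠ i := by
      have : Nontrivial (Fin (n + 1)) := Fin.nontrivial_iff_two_le.2 (by omega)
      exact exists_ne i
    exact ⟨j, Ideal.mul_mem_right _ _ (Ideal.subset_span ⟨i, by simp [hj.symm], rfl⟩)⟩
  obtain ⟨f, hf⟩ := hX x hIP
  rw [Ideal.map_span, ← Set.range_comp] at hf
  obtain ⟨j, hj⟩ := IsLocalRing.exists_mem_span_image_erase _ f hf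
  rw [Set.image_comp, ← Ideal.map_span, Function.comp_apply,
    IsLocalization.algebraMap_mem_map_algebraMap_iff
      x.asHomogeneousIdeal.toIdeal.primeCompl] at hj
  obtain ⟨s, hs, hsj⟩ := hj
  have hhom : (Ideal.span (h '' (Finset.univ.erase j : Finset (Fin (n + 1))))).IsHomogeneous 𝒜 :=
    Ideal.homogeneous_span 𝒜 _ (by rintro _ ⟨i, -, rfl⟩; exact ⟨d, hdeg i⟩)
  -- The homogeneous components of `s` are again multipliers for `j`, hence lie in `P`; so `s` lies
  -- in the core, a contradiction.
  refine hs (x.asHomogeneousIdeal.isHomogeneous.mem_iff.2 fun e => ?_)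
  refine Ideal.mem_homogeneousCore_of_homogeneous_of_mem ⟨e, SetLike.coe_mem _⟩
    (hQP (Ideal.subset_span ⟨j, ?_⟩))
  rw [← DirectSum.coe_decompose_mul_add_of_right_mem 𝒜 (hdeg j)]
  exact hhom (e + d) hsj

end LocallyGenerated

/-! ### Koszul chains over the polynomial ring -/

namespace FinsetKoszul

open MvPolynomial RingTheory.Sequence

section Tower

variable {R S : Type*} [CommRing R] [CommRing S] [Algebra R S] {ι : Type*} [LinearOrder ι]
  {N : Type*} [AddCommGroup N] [Module R N] [Module S N] [IsScalarTower R S N]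

theorem algebraMap_sgn (j : ι) (T : Finset ι) : algebraMap R S (sgn R j T) = sgn S j T := by
  simp [sgn]

/-- Coefficients and homogeneous components are only `A`-linear, so the operators over `A[T]` are
compared with those over `A`. -/
theorem contract_algebraMap (j : ι) (f : Finset ι → N) : contract S N j f = contract R N j f := by
  funext T
  rw [contract_apply, contract_apply, ← algebraMap_sgn (R := R), algebraMap_smul]

theorem diff_algebraMap [Fintype ι] (h : ι → R) (f : Finset ι → N) :
    diff N (fun j => algebraMap R S (h j)) f = diff N h f := by
  rw [diff_apply, diff_apply]
  refine Finset.sum_congr rfl fun j _ => ?_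
  rw [contract_algebraMap (R := R), algebraMap_smul]

end Tower

section Polynomial

variable {A : Type*} [CommRing A] {ι : Type*}

/-- Membership in the monomial ideal of the earlier variables is tested on exponents, and
multiplying by a new variable does not affect the test. -/
theorem isWeaklyRegular_map_X (l : List ι) (hl : l.Nodup) :
    IsWeaklyRegular (MvPolynomial ι A) (l.map X : List (MvPolynomial ι A)) := by
  induction l using List.reverseRecOn with
  | nil => exact .nil _ _
  | append_singleton l j ih =>
    rw [List.nodup_append] at hl
    rw [List.map_append, List.map_singleton, isWeaklyRegular_append_iff,
      isWeaklyRegular_singleton_iff]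
    refine ⟨ih hl.1, ?_⟩
    have hI : Ideal.ofList (l.map X) = Ideal.span (X '' {i | i ∈ l} : Set (MvPolynomial ι A)) := by
      rw [Ideal.ofList]
      congr 1
      ext; simp
    rw [isSMulRegular_quotient_iff_mem_of_smul_mem]
    intro p hp
    rw [smul_eq_mul, smul_eq_mul, Ideal.mul_top, hI, mem_ideal_span_X_image] at hp
    rw [smul_eq_mul, Ideal.mul_top, hI, mem_ideal_span_X_image]
    intro m hm
    obtain ⟨i, hi, him⟩ := hp (Finsupp.single j 1 + m) (by
      rw [mem_support_iff, mul_comm, add_comm, coeff_mul_X]; exact mem_support_iff.1 hm)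
    refine ⟨i, hi, ?_⟩
    have hij : i ≠ j := fun hij => hl.2.2 i hi j (by simp) hij
    simpa [Finsupp.single_apply, hij.symm] using him

theorem homogeneousComponent_succ_X_mul (t : ℕ) (j : ι) (p : MvPolynomial ι A) :
    homogeneousComponent (t + 1) (X j * p) = X j * homogeneousComponent t p := by
  classical
  ext m
  rw [coeff_homogeneousComponent, coeff_X_mul', coeff_X_mul', coeff_homogeneousComponent]
  by_cases hj : j ∈ m.support
  · have hm : m = Finsupp.single j 1 + (m - Finsupp.single j 1) := by
      rw [add_tsub_cancel_of_le]
      simpa using Nat.one_le_iff_ne_zero.2 (Finsupp.mem_support_iff.1 hj)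
    have : m.degree = (m - Finsupp.single j 1).degree + 1 := by
      conv_lhs => rw [hm]
      rw [map_add, Finsupp.degree_single, add_comm]
    simp [hj, this]
  · simp [hj]

theorem homogeneousComponent_zero_X_mul (j : ι) (p : MvPolynomial ι A) :
    homogeneousComponent 0 (X j * p) = 0 := by
  classical
  simp [homogeneousComponent_zero, coeff_X_mul']

variable [LinearOrder ι] [Fintype ι]

/-- The Koszul complex of the variables of a polynomial ring is exact in positive degrees. -/
theorem exists_diff_X_eq {i : ℕ} {x : Finset ι → MvPolynomial ι A}
    (hx : x ∈ chains (MvPolynomial ι A) (MvPolynomial ι A) Finset.univ (i + 1))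
    (hdx : diff (MvPolynomial ι A) (X : ι → MvPolynomial ι A) x = 0) :
    ∃ w ∈ chains (MvPolynomial ι A) (MvPolynomial ι A) Finset.univ (i + 2),
      diff (MvPolynomial ι A) (X : ι → MvPolynomial ι A) w = x :=
  exists_diff_eq (isWeaklyRegular_map_X Finset.univ.toList (Finset.nodup_toList _))
    (fun a ha => by
      obtain ⟨j, -, rfl⟩ := List.mem_map.1 ha
      exact Ideal.subset_span ⟨j, by simp, rfl⟩) hx hdx
    (by rw [List.length_map, Finset.length_toList]; omega)

theorem diff_C (h : ι → A) (f : Finset ι → MvPolynomial ι A) :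
    diff (MvPolynomial ι A) (fun j => C (h j) : ι → MvPolynomial ι A) f =
      diff (MvPolynomial ι A) h f :=
  diff_algebraMap h f

theorem compLeft_diff_C (φ : MvPolynomial ι A →ₗ[A] MvPolynomial ι A) (h : ι → A)
    (f : Finset ι → MvPolynomial ι A) :
    φ.compLeft (Finset ι) (diff (MvPolynomial ι A) (fun j => C (h j) : ι → MvPolynomial ι A) f) =
      diff (MvPolynomial ι A) (fun j => C (h j) : ι → MvPolynomial ι A)
        (φ.compLeft (Finset ι) f) := by
  rw [diff_C, diff_C, diff_comp]

theorem compLeft_diff_X {φ ψ : MvPolynomial ι A →ₗ[A] MvPolynomial ι A}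
    (hφ : ∀ j p, φ (X j * p) = X j * ψ p) (f : Finset ι → MvPolynomial ι A) :
    φ.compLeft (Finset ι) (diff (MvPolynomial ι A) (X : ι → MvPolynomial ι A) f) =
      diff (MvPolynomial ι A) (X : ι → MvPolynomial ι A) (ψ.compLeft (Finset ι) f) := by
  rw [diff_apply, diff_apply, map_sum]
  refine Finset.sum_congr rfl fun j _ => ?_
  rw [contract_algebraMap (R := A) (S := MvPolynomial ι A),
    contract_algebraMap (R := A) (S := MvPolynomial ι A)]
  funext T
  simp only [LinearMap.compLeft_apply, Function.comp_apply, Pi.smul_apply, smul_eq_mul, hφ,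
    contract_apply]
  split_ifs <;> simp

/-- A chain all of whose coefficient vectors are boundaries is a boundary. -/
theorem exists_diff_C_eq_of_coeff (h : ι → A) {k : ℕ} (f : Finset ι → MvPolynomial ι A)
    (hf : ∀ α, (lcoeff A α).compLeft (Finset ι) f ∈
      (chains A A Finset.univ k).map (diff A h)) :
    ∃ w ∈ chains (MvPolynomial ι A) (MvPolynomial ι A) Finset.univ k,
      diff (MvPolynomial ι A) (fun j => C (h j) : ι → MvPolynomial ι A) w = f := by
  classical
  choose w hw hdw using hf
  let T : Finset (ι →₀ ℕ) := Finset.univ.biUnion fun S => (f S).support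
  refine ⟨∑ α ∈ T, (monomial α : A →ₗ[A] MvPolynomial ι A).compLeft (Finset ι) (w α),
    Submodule.sum_mem _ fun α _ => ?_, ?_⟩
  · exact comp_mem_chains (R := A) _ (hw α)
  · rw [diff_C, map_sum]
    simp_rw [diff_comp, hdw]
    funext S
    rw [Finset.sum_apply]
    simp only [LinearMap.compLeft_apply, Function.comp_apply, lcoeff_apply]
    conv_rhs => rw [← support_sum_monomial_coeff (f S)]
    refine (Finset.sum_subset (fun α hα => ?_) fun α _ hα => ?_).symm
    · exact Finset.mem_biUnion.2 ⟨S, Finset.mem_univ _, hα⟩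
    · rw [notMem_support_iff.1 hα, map_zero]

/-- If a linear form with constant coefficients `c` multiplies `u` into the boundaries, then so
does a power of any of the coefficients. -/
theorem exists_diff_C_eq_pow_smul (h c : ι → A) (j : ι) {k : ℕ}
    {u b : Finset ι → MvPolynomial ι A}
    (hb : b ∈ chains (MvPolynomial ι A) (MvPolynomial ι A) Finset.univ k)
    (hub : diff (MvPolynomial ι A) (fun j => C (h j) : ι → MvPolynomial ι A) b =
      (∑ i, C (c i) * X i : MvPolynomial ι A) • u) :
    ∃ D, ∃ w ∈ chains (MvPolynomial ι A) (MvPolynomial ι A) Finset.univ k,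
      diff (MvPolynomial ι A) (fun j => C (h j) : ι → MvPolynomial ι A) w =
        (C (c j) : MvPolynomial ι A) ^ D • u := by
  classical
  set B := (chains A A Finset.univ k).map (diff A h) with hB
  obtain ⟨D, hD⟩ : ∃ D, ∀ α : ι →₀ ℕ, D ≤ α j → (lcoeff A α).compLeft (Finset ι) u = 0 := by
    refine ⟨(Finset.univ.sup fun S => (u S).degreeOf j) + 1, fun α hα => funext fun S => ?_⟩
    simp only [LinearMap.compLeft_apply, Function.comp_apply, lcoeff_apply, Pi.zero_apply]
    by_contra hne
    have h1 := (degreeOf_le_iff (n := j) (f := u S) (d := _)).1 le_rfl α (mem_support_iff.2 hne)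
    have h2 := Finset.le_sup (f := fun S => (u S).degreeOf j) (Finset.mem_univ S)
    omega
  -- This is the coefficient of the product at `α + e_j`. The case split guards against truncated
  -- subtraction of exponents.
  have hcoef : ∀ α : ι →₀ ℕ, ∑ i, c i • (if (α + Finsupp.single j 1 : ι →₀ ℕ) i = 0 then 0 else
      (lcoeff A (α + Finsupp.single j 1 - Finsupp.single i 1)).compLeft (Finset ι) u) ∈ B := by
    intro α
    have h1 : (lcoeff A (α + Finsupp.single j 1)).compLeft (Finset ι)
        ((∑ i, C (c i) * X i : MvPolynomial ι A) • u) ∈ B := by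
      rw [← hub, diff_C, ← diff_comp]
      exact Submodule.mem_map_of_mem (comp_mem_chains (R := A) _ hb)
    convert h1 using 1
    funext S
    simp only [LinearMap.compLeft_apply, Function.comp_apply, lcoeff_apply, Pi.smul_apply,
      smul_eq_mul, Finset.sum_mul, coeff_sum, Finset.sum_apply]
    refine Finset.sum_congr rfl fun i _ => ?_
    rw [mul_assoc, coeff_C_mul, coeff_X_mul']
    congr 1
    by_cases hi : (α + Finsupp.single j 1 : ι →₀ ℕ) i = 0
    · rw [if_pos hi, if_neg (by simpa using hi)]; rfl
    · rw [if_neg hi, if_pos (Finsupp.mem_support_iff.2 hi)]; rfl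
  -- Descending induction on the exponent of `T_j`: in the coefficient at `α + e_j`, the term `i =
  -- j` is `c j • u_α`, and all others involve coefficients of `u` with `T_j`-exponent `α j + 1`.
  have key : ∀ e, ∀ α : ι →₀ ℕ, D ≤ α j + e →
      c j ^ e • (lcoeff A α).compLeft (Finset ι) u ∈ B := by
    intro e
    induction e with
    | zero => intro α hα; rw [hD α hα, smul_zero]; exact zero_mem _
    | succ e ih =>
      intro α hα
      have h1 := B.smul_mem (c j ^ e) (hcoef α)
      rw [← Finset.add_sum_erase _ _ (Finset.mem_univ j), smul_add, if_neg (by simp),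
        add_tsub_cancel_right, smul_smul, ← pow_succ] at h1
      refine (B.add_mem_iff_left ?_).1 h1
      rw [Finset.smul_sum]
      refine B.sum_mem fun i hi => ?_
      rw [smul_comm]
      refine B.smul_mem _ ?_
      split_ifs with h0
      · rw [smul_zero]; exact zero_mem _
      · refine ih _ ?_
        have hij : i ≠ j := Finset.ne_of_mem_erase hi
        simp [hij]
        omega
  refine ⟨D, exists_diff_C_eq_of_coeff h _ fun α => ?_⟩
  have : (lcoeff A α).compLeft (Finset ι) ((C (c j) : MvPolynomial ι A) ^ D • u) =
      c j ^ D • (lcoeff A α).compLeft (Finset ι) u := by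
    funext S
    simp only [LinearMap.compLeft_apply, Function.comp_apply, Pi.smul_apply, smul_eq_mul,
      lcoeff_apply, ← C_pow, coeff_C_mul]
  rw [this]
  exact key D α (by omega)

/-- Acyclicity of the approximation complex from two properties of the Koszul complex `(K, δ)`
of `h` and the differential `ε` of `K[T]`: the vanishing of the Koszul homology in degrees at
least `3`, and the injectivity of the map induced by `ε` on Koszul homology in degree `2`. -/
theorem exists_diff_X_eq_of_diff_C_eq_zero (h : ι → A)
    (hvan : ∀ i, ∀ x ∈ chains (MvPolynomial ι A) (MvPolynomial ι A) Finset.univ (i + 3),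
      diff (MvPolynomial ι A) (fun j => C (h j) : ι → MvPolynomial ι A) x = 0 →
      ∃ w ∈ chains (MvPolynomial ι A) (MvPolynomial ι A) Finset.univ (i + 4),
        diff (MvPolynomial ι A) (fun j => C (h j) : ι → MvPolynomial ι A) w = x)
    (htwo : ∀ z ∈ chains (MvPolynomial ι A) (MvPolynomial ι A) Finset.univ 2,
      ∀ r ∈ chains (MvPolynomial ι A) (MvPolynomial ι A) Finset.univ 2,
      diff (MvPolynomial ι A) (fun j => C (h j) : ι → MvPolynomial ι A) z = 0 →
      diff (MvPolynomial ι A) (X : ι → MvPolynomial ι A) z =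
        diff (MvPolynomial ι A) (fun j => C (h j) : ι → MvPolynomial ι A) r →
      ∃ w ∈ chains (MvPolynomial ι A) (MvPolynomial ι A) Finset.univ 3,
        diff (MvPolynomial ι A) (fun j => C (h j) : ι → MvPolynomial ι A) w = z)
    {i : ℕ} {x : Finset ι → MvPolynomial ι A}
    (hx : x ∈ chains (MvPolynomial ι A) (MvPolynomial ι A) Finset.univ (i + 1))
    (hδ : diff (MvPolynomial ι A) (fun j => C (h j) : ι → MvPolynomial ι A) x = 0)
    (hε : diff (MvPolynomial ι A) (X : ι → MvPolynomial ι A) x = 0) :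
    ∃ r ∈ chains (MvPolynomial ι A) (MvPolynomial ι A) Finset.univ (i + 2),
      diff (MvPolynomial ι A) (fun j => C (h j) : ι → MvPolynomial ι A) r = 0 ∧
      diff (MvPolynomial ι A) (X : ι → MvPolynomial ι A) r = x := by
  classical
  set δ := diff (MvPolynomial ι A) (fun j => C (h j) : ι → MvPolynomial ι A)
  set ε := diff (MvPolynomial ι A) (X : ι → MvPolynomial ι A) with hεdef
  let π : ℕ → (Finset ι → MvPolynomial ι A) →ₗ[A] (Finset ι → MvPolynomial ι A) :=
    fun t => (homogeneousComponent t).compLeft (Finset ι)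
  have πmem : ∀ t k x, x ∈ chains (MvPolynomial ι A) (MvPolynomial ι A) Finset.univ k →
      π t x ∈ chains (MvPolynomial ι A) (MvPolynomial ι A) Finset.univ k :=
    fun t k x hx => comp_mem_chains (R := A) _ hx
  have πδ : ∀ t x, π t (δ x) = δ (π t x) := fun t x => compLeft_diff_C _ h x
  have πε : ∀ t x, π (t + 1) (ε x) = ε (π t x) := fun t x =>
    compLeft_diff_X (homogeneousComponent_succ_X_mul t) x
  have πε0 : ∀ x, π 0 (ε x) = 0 := fun x => by
    have := compLeft_diff_X (φ := homogeneousComponent 0) (ψ := 0)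
      (fun j p => by rw [homogeneousComponent_zero_X_mul]; simp) x
    refine this.trans ?_
    convert map_zero ε
    funext S
    simp
  have ππ : ∀ t x, π t (π t x) = π t x := fun t x => funext fun S => by
    simp [π, homogeneousComponent_of_mem (homogeneousComponent_mem t (x S))]
  have main : ∀ t i x, x ∈ chains (MvPolynomial ι A) (MvPolynomial ι A) Finset.univ (i + 1) →
      δ x = 0 → ε x = 0 → π t x = x →
      ∃ r ∈ chains (MvPolynomial ι A) (MvPolynomial ι A) Finset.univ (i + 2),
        δ r = 0 ∧ ε r = x := by
    intro t
    induction t with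
    | zero =>
      intro i x hx hδ hε hπ
      obtain ⟨r, hr, rfl⟩ := exists_diff_X_eq hx hε
      refine ⟨0, zero_mem _, map_zero _, ?_⟩
      rw [map_zero, ← hπ, πε0]
    | succ t ih =>
      intro i x hx hδ hε hπ
      obtain ⟨r, hr, rfl⟩ := exists_diff_X_eq hx hε
      rw [← hεdef, πε] at hπ
      rw [← hεdef, ← hπ] at hδ ⊢
      have hr' := πmem t _ _ hr
      have hrπ := ππ t r
      set r' := π t r
      -- `δ r'` has degree `t` in the variables, one less than `ε r'`, and anticommutation makes it
      -- an `ε`-cycle.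
      obtain ⟨z, hz, hδz, hεz⟩ := ih i (δ r') (diff_mem_chains _ hr') (diff_diff _ _)
        (by rw [hεdef, diff_anticomm, hδ, neg_zero]) (by rw [πδ, hrπ])
      obtain ⟨w, hw, rfl⟩ : ∃ w ∈ chains (MvPolynomial ι A) (MvPolynomial ι A) Finset.univ (i + 3),
          δ w = z := by
        cases i with
        | zero => exact htwo z hz r' hr' hδz hεz
        | succ i => exact hvan i z hz hδz
      refine ⟨r' + ε w, add_mem hr' (diff_mem_chains _ hw), ?_, ?_⟩
      · rw [map_add, ← hεz, hεdef, diff_anticomm X, neg_add_cancel]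
      · rw [map_add, hεdef, diff_diff, add_zero]
  obtain ⟨B, hB⟩ : ∃ B, ∑ t ∈ Finset.range B, π t x = x := by
    refine ⟨(Finset.univ.sup fun S => (x S).totalDegree) + 1, funext fun S => ?_⟩
    rw [Finset.sum_apply]
    conv_rhs => rw [← sum_homogeneousComponent (x S)]
    refine (Finset.sum_subset (fun t ht => ?_) fun t _ ht => ?_).symm
    · have := Finset.le_sup (f := fun S => (x S).totalDegree) (Finset.mem_univ S)
      simp only [Finset.mem_range] at ht ⊢
      omega
    · exact homogeneousComponent_eq_zero _ _ (by simpa [Nat.lt_succ_iff] using ht)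
  have hεπ : ∀ t, ε (π t x) = 0 := fun t => by rw [← πε, hε, map_zero]
  choose r hr hδr hεr using fun t => main t i (π t x) (πmem t _ x hx)
    (by rw [← πδ, hδ, map_zero]) (hεπ t) (ππ t x)
  refine ⟨∑ t ∈ Finset.range B, r t, Submodule.sum_mem _ fun t _ => hr t, ?_, ?_⟩
  · rw [map_sum, Finset.sum_eq_zero fun t _ => hδr t]
  · rw [map_sum, Finset.sum_congr rfl fun t _ => hεr t, hB]

end Polynomial

end FinsetKoszul

/-! ### Injectivity on the second Koszul homology -/

namespace FinsetKoszul

open MvPolynomial RingTheory.Sequence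

theorem chains_mono {R ι M : Type*} [CommRing R] [AddCommGroup M] [Module R M] {U V : Finset ι}
    (h : U ⊆ V) (i : ℕ) : chains R M U i ≤ chains R M V i :=
  fun _ hf S hS => ⟨(hf S hS).1.trans h, (hf S hS).2⟩

section Support

variable {R : Type*} [CommRing R] {ι : Type*} [LinearOrder ι] {M : Type*} [AddCommGroup M]
  [Module R M]

theorem mem_chains_erase_of_contract_eq_zero {U : Finset ι} {i : ℕ} {f : Finset ι → M} {j : ι}
    (hf : f ∈ chains R M U i) (hj : contract R M j f = 0) : f ∈ chains R M (U.erase j) i := by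
  intro S hS
  obtain ⟨h1, h2⟩ := hf S hS
  refine ⟨Finset.subset_erase.2 ⟨h1, fun hjS => hS ?_⟩, h2⟩
  have h3 := congrFun hj (S.erase j)
  rw [contract_apply, if_neg (Finset.notMem_erase j S), Finset.insert_erase hjS, Pi.zero_apply]
    at h3
  have h4 := congrArg (sgn R j (S.erase j) • ·) h3
  simpa only [smul_smul, sgn_mul_self, one_smul, smul_zero] using h4

end Support

variable {A : Type*} [CommRing A] {ι : Type*} [LinearOrder ι] [Fintype ι]

theorem mul_mem_span_erase {h : ι → A} {s : A} {j : ι}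
    (hs : s * h j ∈ Ideal.span (h '' (Finset.univ.erase j : Finset ι))) {a : A}
    (ha : a ∈ Ideal.span (Set.range h)) :
    s * a ∈ Ideal.span (h '' (Finset.univ.erase j : Finset ι)) := by
  induction ha using Submodule.span_induction with
  | mem x hx =>
    obtain ⟨i, rfl⟩ := hx
    by_cases hij : i = j
    · rw [hij]; exact hs
    · exact Ideal.mul_mem_left _ _ (Ideal.subset_span ⟨i, by simp [hij], rfl⟩)
  | zero => rw [mul_zero]; exact zero_mem _
  | add x y _ _ hx hy => rw [mul_add]; exact add_mem hx hy
  | smul c x _ hx => rw [smul_eq_mul, mul_left_comm]; exact Ideal.mul_mem_left _ _ hx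

theorem C_mem_span_image {A ι : Type*} [CommRing A] {h : ι → A} {U : Finset ι} {a : A} (ha : a ∈ Ideal.span (h '' U)) :
    (C a : MvPolynomial ι A) ∈ Ideal.span ((fun j => C (h j) : ι → MvPolynomial ι A) '' U) := by
  have := Ideal.mem_map_of_mem (C : A →+* MvPolynomial ι A) ha
  rwa [Ideal.map_span, ← Set.image_comp] at this

/-- A class in Koszul homology of degree `2` killed by the map induced by `ε` is killed by a power
of any element `s` that makes one of the generators redundant. -/
theorem exists_diff_C_eq_pow_smul_of_redundant (h : ι → A) {as : List A}
    (has : IsWeaklyRegular A as) (hmem : ∀ a ∈ as, a ∈ Ideal.span (Set.range h))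
    (hcard : Fintype.card ι ≤ as.length + 2) {s : A} {j : ι}
    (hs : s * h j ∈ Ideal.span (h '' (Finset.univ.erase j : Finset ι)))
    {z r : Finset ι → MvPolynomial ι A}
    (hz : z ∈ chains (MvPolynomial ι A) (MvPolynomial ι A) Finset.univ 2)
    (hr : r ∈ chains (MvPolynomial ι A) (MvPolynomial ι A) Finset.univ 2)
    (hδz : diff (MvPolynomial ι A) (fun j => C (h j) : ι → MvPolynomial ι A) z = 0)
    (hzr : diff (MvPolynomial ι A) (X : ι → MvPolynomial ι A) z =
        diff (MvPolynomial ι A) (fun j => C (h j) : ι → MvPolynomial ι A) r) :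
    ∃ k, ∃ w ∈ chains (MvPolynomial ι A) (MvPolynomial ι A) Finset.univ 3,
      diff (MvPolynomial ι A) (fun j => C (h j) : ι → MvPolynomial ι A) w =
        (C s : MvPolynomial ι A) ^ k • z := by
  classical
  obtain ⟨a, haj, ha⟩ := exists_coeff_of_mem_span hs
  -- The redundancy of `h j` up to `s`, written as a relation with `j`-th coefficient `s`.
  obtain ⟨c, hcj, hc⟩ : ∃ c : ι → A, c j = s ∧ ∑ i, c i * h i = 0 := by
    refine ⟨Pi.single j s - a, by simp [haj j (by simp)], ?_⟩
    simp only [Pi.sub_apply, sub_mul, Finset.sum_sub_distrib, ha]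
    rw [Finset.sum_eq_single j (fun i _ hij => by rw [Pi.single_eq_of_ne hij, zero_mul]) (by simp),
      Pi.single_eq_same, sub_self]
  have hδW : ∀ x, diff (MvPolynomial ι A) (fun j => C (h j) : ι → MvPolynomial ι A)
      (vecWedge (MvPolynomial ι A) (fun i => C (c i) : ι → MvPolynomial ι A) x) =
      -vecWedge (MvPolynomial ι A) (fun i => C (c i) : ι → MvPolynomial ι A)
        (diff (MvPolynomial ι A) (fun j => C (h j) : ι → MvPolynomial ι A) x) := fun x => by
    rw [diff_vecWedge]
    simp only [← C_mul, ← map_sum, hc, C_0, zero_smul, zero_sub]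
  have hεW : ∀ x, diff (MvPolynomial ι A) (X : ι → MvPolynomial ι A)
      (vecWedge (MvPolynomial ι A) (fun i => C (c i) : ι → MvPolynomial ι A) x) =
      (∑ i, C (c i) * X i : MvPolynomial ι A) • x -
      vecWedge (MvPolynomial ι A) (fun i => C (c i) : ι → MvPolynomial ι A)
        (diff (MvPolynomial ι A) (X : ι → MvPolynomial ι A) x) := fun x => diff_vecWedge _ _ _
  have hjW : ∀ x, contract (MvPolynomial ι A) (MvPolynomial ι A) j
      (vecWedge (MvPolynomial ι A) (fun i => C (c i) : ι → MvPolynomial ι A) x) =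
      (C s : MvPolynomial ι A) • x -
      vecWedge (MvPolynomial ι A) (fun i => C (c i) : ι → MvPolynomial ι A)
        (contract (MvPolynomial ι A) (MvPolynomial ι A) j x) := fun x => by
    rw [← diff_single, diff_vecWedge]
    congr 2
    rw [Finset.sum_eq_single j (fun i _ hij => by rw [Pi.single_eq_of_ne hij, mul_zero]) (by simp),
      Pi.single_eq_same, mul_one, hcj]
  have hδj : ∀ x, diff (MvPolynomial ι A) (fun j => C (h j) : ι → MvPolynomial ι A)
      (contract (MvPolynomial ι A) (MvPolynomial ι A) j x) =
      -contract (MvPolynomial ι A) (MvPolynomial ι A) j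
        (diff (MvPolynomial ι A) (fun j => C (h j) : ι → MvPolynomial ι A) x) := fun x => by
    rw [← diff_single, diff_anticomm]
  have hεj : ∀ x, diff (MvPolynomial ι A) (X : ι → MvPolynomial ι A)
      (contract (MvPolynomial ι A) (MvPolynomial ι A) j x) =
      -contract (MvPolynomial ι A) (MvPolynomial ι A) j
        (diff (MvPolynomial ι A) (X : ι → MvPolynomial ι A) x) := fun x => by
    rw [← diff_single, diff_anticomm]
  have hδε : ∀ x, diff (MvPolynomial ι A) (X : ι → MvPolynomial ι A)
      (diff (MvPolynomial ι A) (fun j => C (h j) : ι → MvPolynomial ι A) x) =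
      -diff (MvPolynomial ι A) (fun j => C (h j) : ι → MvPolynomial ι A)
        (diff (MvPolynomial ι A) (X : ι → MvPolynomial ι A) x) := diff_anticomm _ _
  have hWmem : ∀ i x, x ∈ chains (MvPolynomial ι A) (MvPolynomial ι A) Finset.univ i →
      vecWedge (MvPolynomial ι A) (fun i => C (c i) : ι → MvPolynomial ι A) x ∈
        chains (MvPolynomial ι A) (MvPolynomial ι A) Finset.univ (i + 1) := fun i x hx =>
    vecWedge_mem_chains (by simp) hx
  have hεmem : ∀ i x, x ∈ chains (MvPolynomial ι A) (MvPolynomial ι A) Finset.univ (i + 1) →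
      diff (MvPolynomial ι A) (X : ι → MvPolynomial ι A) x ∈
        chains (MvPolynomial ι A) (MvPolynomial ι A) Finset.univ i := fun i x hx =>
    diff_mem_chains _ hx
  have hvan := exists_diff_eq_pow_smul (fun j => C (h j) : ι → MvPolynomial ι A)
    (Finset.univ.erase j) (C s) (as.map (algebraMap A (MvPolynomial ι A))) (MvPolynomial ι A)
    has.of_flat (fun b hb => by
      obtain ⟨b, hb', rfl⟩ := List.mem_map.1 hb
      rw [algebraMap_eq, ← C_mul]
      exact C_mem_span_image (mul_mem_span_erase hs (hmem b hb'))) 2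
  rw [List.length_map] at hvan
  have hτ := fun u b => exists_diff_C_eq_pow_smul h c j (k := 2) (u := u) (b := b)
  rw [hcj] at hτ
  set δ := diff (MvPolynomial ι A) (fun j => C (h j) : ι → MvPolynomial ι A)
  set ε := diff (MvPolynomial ι A) (X : ι → MvPolynomial ι A)
  set W := vecWedge (MvPolynomial ι A) (fun i => C (c i) : ι → MvPolynomial ι A)
  have humem := contract_mem_chains j hz
  have hyr := contract_mem_chains j hr
  obtain ⟨u, hu⟩ : ∃ u, u = contract (MvPolynomial ι A) (MvPolynomial ι A) j z := ⟨_, rfl⟩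
  obtain ⟨y, hy⟩ : ∃ y, y = contract (MvPolynomial ι A) (MvPolynomial ι A) j r := ⟨_, rfl⟩
  rw [← hu] at humem
  rw [← hy] at hyr
  have hju : contract (MvPolynomial ι A) (MvPolynomial ι A) j u = 0 := by
    rw [hu]; exact LinearMap.congr_fun (contract_mul_self j) z
  have hδu : δ u = 0 := by rw [hu, hδj, hδz, map_zero, neg_zero]
  have hεu : ε u = δ y := by rw [hu, hεj, hzr, hy, hδj]
  -- This cycle is killed by contraction with `j`, so it lives on the other generators. Their ideal
  -- contains `s` times the sequence `as`, so a power of `s` makes the cycle a boundary.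
  obtain ⟨w, hw, hδw⟩ := hvan ((C s : MvPolynomial ι A) • z - W u)
    (mem_chains_erase_of_contract_eq_zero
      (Submodule.sub_mem _ (Submodule.smul_mem _ _ hz) (hWmem 1 u humem))
      (by rw [map_sub, map_smul, hjW, ← hu, hju, map_zero, sub_zero, sub_self]))
    (by rw [map_sub, map_smul, hδz, hδW, hδu, map_zero, smul_zero, neg_zero, sub_zero])
    (by
      have := Finset.card_pos.2 ⟨j, Finset.mem_univ j⟩
      rw [Finset.card_erase_of_mem (Finset.mem_univ j)]
      rw [Finset.card_univ] at this ⊢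
      omega)
  replace hw := chains_mono (Finset.subset_univ _) _ hw
  -- Applying `ε` to the previous equation shows that the linear form `∑ c i * T_i` times `s ^
  -- as.length • u` is a boundary; its coefficient `c j = s` then has a power that does the same.
  obtain ⟨D, w₂, hw₂, hδw₂⟩ := hτ ((C s : MvPolynomial ι A) ^ as.length • u)
    ((C s : MvPolynomial ι A) ^ as.length • ((C s : MvPolynomial ι A) • r - W y) + ε w)
    (add_mem (Submodule.smul_mem _ _ (Submodule.sub_mem _ (Submodule.smul_mem _ _ hr)
      (hWmem 1 y hyr))) (hεmem 2 w hw)) (by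
      have h1 := hδε w
      rw [hδw, map_smul, map_sub, map_smul, hzr, hεW, hεu] at h1
      rw [map_add, ← neg_eq_iff_eq_neg.2 h1, map_smul, map_sub, map_smul, hδW, smul_comm _ _ u]
      simp only [smul_sub, smul_add, sub_neg_eq_add]
      abel)
  -- `s • z` is recovered as `(s • z - W u) + W u`, both parts now being boundaries up to powers of
  -- `s`.
  refine ⟨D + as.length + 1, (C s : MvPolynomial ι A) ^ D • w - W w₂, Submodule.sub_mem _
    (Submodule.smul_mem _ _ hw) (hWmem 2 w₂ hw₂), ?_⟩
  rw [map_sub, map_smul, hδw, hδW, hδw₂, map_smul, map_smul]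
  simp only [smul_sub, smul_smul, pow_add, pow_one, mul_assoc]
  simp

/-- Under the hypotheses on depth and local generation, the map induced by `ε` on Koszul homology
is injective in degree `2`. -/
theorem exists_diff_C_eq_of_diff_X_eq (h : ι → A) {as : List A} {y : A}
    (has : IsWeaklyRegular A (as ++ [y])) (hmem : ∀ a ∈ as, a ∈ Ideal.span (Set.range h))
    (hcard : Fintype.card ι ≤ as.length + 2)
    (hy : y ∈ (Ideal.span {s : A | ∃ j, s * h j ∈
      Ideal.span (h '' (Finset.univ.erase j : Finset ι))}).radical)
    {z r : Finset ι → MvPolynomial ι A}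
    (hz : z ∈ chains (MvPolynomial ι A) (MvPolynomial ι A) Finset.univ 2)
    (hr : r ∈ chains (MvPolynomial ι A) (MvPolynomial ι A) Finset.univ 2)
    (hδz : diff (MvPolynomial ι A) (fun j => C (h j) : ι → MvPolynomial ι A) z = 0)
    (hzr : diff (MvPolynomial ι A) (X : ι → MvPolynomial ι A) z =
        diff (MvPolynomial ι A) (fun j => C (h j) : ι → MvPolynomial ι A) r) :
    ∃ w ∈ chains (MvPolynomial ι A) (MvPolynomial ι A) Finset.univ 3,
      diff (MvPolynomial ι A) (fun j => C (h j) : ι → MvPolynomial ι A) w = z := by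
  set B := (chains (MvPolynomial ι A) (MvPolynomial ι A) Finset.univ 3).map
    (diff (MvPolynomial ι A) (fun j => C (h j) : ι → MvPolynomial ι A)) with hB
  -- `J` is the annihilator in `A` of the class of `z` modulo boundaries.
  let J : Ideal A := Ideal.comap C (B.comap (LinearMap.toSpanSingleton (MvPolynomial ι A) _ z))
  have hJ : ∀ s, s ∈ J ↔ (C s : MvPolynomial ι A) • z ∈ B := fun s => Iff.rfl
  have hle : (Ideal.span {s : A | ∃ j, s * h j ∈
      Ideal.span (h '' (Finset.univ.erase j : Finset ι))}).radical ≤ J.radical := by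
    rw [Ideal.radical_le_radical_iff, Ideal.span_le]
    rintro s ⟨j, hs⟩
    obtain ⟨k, w, hw, hδw⟩ := exists_diff_C_eq_pow_smul_of_redundant h
      ((isWeaklyRegular_append_iff A _ _).1 has).1 hmem hcard hs hz hr hδz hzr
    refine ⟨k, (hJ _).2 ?_⟩
    rw [C_pow]
    exact ⟨w, hw, hδw⟩
  obtain ⟨k, hk⟩ := hle hy
  have hreg := has.of_flat (S := MvPolynomial ι A)
  rw [List.map_append, List.map_singleton] at hreg
  suffices H : ∀ k, (C y : MvPolynomial ι A) ^ k • z ∈ B → z ∈ B by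
    exact H k (by rw [← C_pow]; exact (hJ _).1 hk)
  intro k
  induction k with
  | zero => intro h; simpa using h
  | succ k ih =>
    rintro ⟨w, hw, hδw⟩
    obtain ⟨w', hw', hδw'⟩ := exists_diff_eq_of_smul _ Finset.univ _ _ _ hreg
      (fun b hb => by
        obtain ⟨b, hb', rfl⟩ := List.mem_map.1 hb
        rw [algebraMap_eq]
        exact C_mem_span_image (by simpa using hmem b hb')) 2
      ((C y : MvPolynomial ι A) ^ k • z) w (Submodule.smul_mem _ _ hz)
      (by rw [map_smul, hδz, smul_zero])
      (by rw [List.length_map, Finset.card_univ]; omega) hw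
      (by rw [hδw, pow_succ', mul_smul, algebraMap_eq])
    exact ih ⟨w', hw', hδw'⟩

/-- Acyclicity of the approximation complex, in terms of Koszul chains over the polynomial ring. -/
theorem exists_diff_X_eq_of_isWeaklyRegular (h : ι → A) {as : List A}
    (has : IsWeaklyRegular A as) (hmem : ∀ a ∈ as, a ∈ Ideal.span (Set.range h))
    (hcard : Fintype.card ι ≤ as.length + 2)
    (hy : Fintype.card ι = 1 ∨ ∃ y, IsWeaklyRegular A (as ++ [y]) ∧
      y ∈ (Ideal.span {s : A | ∃ j, s * h j ∈
        Ideal.span (h '' (Finset.univ.erase j : Finset ι))}).radical)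
    {i : ℕ} {x : Finset ι → MvPolynomial ι A}
    (hx : x ∈ chains (MvPolynomial ι A) (MvPolynomial ι A) Finset.univ (i + 1))
    (hδ : diff (MvPolynomial ι A) (fun j => C (h j) : ι → MvPolynomial ι A) x = 0)
    (hε : diff (MvPolynomial ι A) (X : ι → MvPolynomial ι A) x = 0) :
    ∃ r ∈ chains (MvPolynomial ι A) (MvPolynomial ι A) Finset.univ (i + 2),
      diff (MvPolynomial ι A) (fun j => C (h j) : ι → MvPolynomial ι A) r = 0 ∧
      diff (MvPolynomial ι A) (X : ι → MvPolynomial ι A) r = x := by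
  refine exists_diff_X_eq_of_diff_C_eq_zero h (fun i x hx hdx => ?_) (fun z hz r hr hδz hzr => ?_)
    hx hδ hε
  · exact exists_diff_eq (has.of_flat (S := MvPolynomial ι A)) (fun b hb => by
        obtain ⟨b, hb', rfl⟩ := List.mem_map.1 hb
        rw [algebraMap_eq]
        exact C_mem_span_image (by simpa using hmem b hb')) hx hdx
        (by rw [List.length_map, Finset.card_univ]; omega)
  · rcases hy with hy | ⟨y, hreg, hy⟩
    · refine ⟨0, zero_mem _, ?_⟩
      rw [map_zero, eq_zero_of_card_lt (by rw [Finset.card_univ, hy]; norm_num) hz]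
    · exact exists_diff_C_eq_of_diff_X_eq h hreg hmem hcard hy hz hr hδz hzr

end FinsetKoszul

/-! ### Passage from the exterior algebra to coordinates -/

namespace FinsetKoszul

open MvPolynomial ApproximationComplex

variable {A : Type*} [CommRing A] {ι : Type*} [LinearOrder ι] [Fintype ι]

theorem linearCombination_wedge_mul_self (c : ι → A) :
    Fintype.linearCombination A (wedge A A) c * Fintype.linearCombination A (wedge A A) c = 0 :=
  vecWedge_mul_self c

/-- The action of the exterior algebra on functions on finite subsets, by exterior
multiplication. -/
noncomputable def exteriorAction (A ι : Type*) [CommRing A] [LinearOrder ι] [Fintype ι] :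
    ExteriorAlgebra A (ι → A) →ₐ[A] Module.End A (Finset ι → A) :=
  ExteriorAlgebra.lift A ⟨Fintype.linearCombination A (wedge A A), linearCombination_wedge_mul_self⟩

/-- The coordinates of an element of the exterior algebra, indexed by finite subsets. -/
noncomputable def exteriorCoord (A ι : Type*) [CommRing A] [LinearOrder ι] [Fintype ι] :
    ExteriorAlgebra A (ι → A) →ₗ[A] (Finset ι → A) :=
  (LinearMap.applyₗ (Pi.single ∅ 1 : Finset ι → A)).comp (exteriorAction A ι).toLinearMap

theorem exteriorCoord_ι_mul (c : ι → A) (x : ExteriorAlgebra A (ι → A)) :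
    exteriorCoord A ι (ExteriorAlgebra.ι A c * x) = vecWedge A c (exteriorCoord A ι x) := by
  simp only [exteriorCoord, LinearMap.comp_apply, AlgHom.toLinearMap_apply, map_mul,
    LinearMap.applyₗ_apply_apply, Module.End.mul_apply]
  rw [exteriorAction, ExteriorAlgebra.lift_ι_apply]
  rfl

theorem exteriorCoord_algebraMap (a : A) :
    exteriorCoord A ι (algebraMap A _ a) = Pi.single ∅ a := by
  simp only [exteriorCoord, LinearMap.comp_apply, AlgHom.toLinearMap_apply,
    LinearMap.applyₗ_apply_apply, AlgHom.commutes, Module.algebraMap_end_apply]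
  rw [← Pi.single_smul, smul_eq_mul, mul_one]

theorem single_mem_chains (S : Finset ι) (a : A) :
    (Pi.single S a : Finset ι → A) ∈ chains A A Finset.univ S.card := by
  intro T hT
  by_cases h : T = S
  · simp [h]
  · exact (hT (by rw [Pi.single_apply, if_neg h])).elim

theorem contract_single_empty {A ι : Type*} [CommRing A] [LinearOrder ι] (j : ι) (a : A) :
    contract A A j (Pi.single ∅ a : Finset ι → A) = 0 := by
  funext S
  rw [contract_apply, Pi.single_eq_of_ne (Finset.insert_ne_empty j S)]
  simp

theorem exteriorCoord_koszulD (h : ι → A) (x : ExteriorAlgebra A (ι → A)) :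
    exteriorCoord A ι (koszulD h x) = diff A h (exteriorCoord A ι x) := by
  induction x using CliffordAlgebra.left_induction with
  | algebraMap r =>
    rw [koszulD, CliffordAlgebra.contractLeft_algebraMap, map_zero]
    refine Eq.symm ?_
    refine (congrArg (diff A h) (exteriorCoord_algebraMap r)).trans ?_
    simp [diff_apply, contract_single_empty]
  | add x y hx hy => rw [map_add, map_add, map_add, map_add, hx, hy]
  | ι_mul x m hx =>
    have h1 : koszulD h (ExteriorAlgebra.ι A m * x) =
        form h m • x - ExteriorAlgebra.ι A m * koszulD h x :=
      CliffordAlgebra.contractLeft_ι_mul (d := form h) m x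
    refine (congrArg (exteriorCoord A ι) h1).trans ?_
    refine Eq.trans ?_ (congrArg (diff A h) (exteriorCoord_ι_mul m x)).symm
    rw [map_sub, map_smul, exteriorCoord_ι_mul, diff_vecWedge, hx]
    rfl

theorem exteriorCoord_mem_chains (i : ℕ) :
    ∀ x ∈ ⋀[A]^i (ι → A), exteriorCoord A ι x ∈ chains A A Finset.univ i := by
  induction i with
  | zero =>
    intro x hx
    rw [ExteriorAlgebra.exteriorPower, pow_zero] at hx
    obtain ⟨a, rfl⟩ := Submodule.mem_one.1 hx
    rw [exteriorCoord_algebraMap]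
    exact single_mem_chains ∅ a
  | succ i ih =>
    intro x hx
    rw [ExteriorAlgebra.exteriorPower, pow_succ'] at hx
    refine Submodule.mul_induction_on hx ?_ fun x y hx hy => ?_
    · rintro _ ⟨m, rfl⟩ y hy
      rw [exteriorCoord_ι_mul]
      exact vecWedge_mem_chains (by simp) (ih y hy)
    · rw [map_add]
      exact add_mem hx hy

theorem wedge_single {A ι : Type*} [CommRing A] [LinearOrder ι] {j : ι} {S : Finset ι} (hj : j ∉ S) :
    wedge A A j (Pi.single S 1 : Finset ι → A) = sgn A j S • Pi.single (insert j S) 1 := by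
  funext T
  rw [wedge_apply, Pi.smul_apply]
  by_cases hT : T = insert j S
  · subst hT
    rw [if_pos (Finset.mem_insert_self j S), Finset.erase_insert hj, Pi.single_eq_same,
      Pi.single_eq_same, sgn_insert_self]
  · rw [Pi.single_eq_of_ne hT, smul_zero]
    split_ifs with hjT
    · rw [Pi.single_eq_of_ne, smul_zero]
      rintro rfl
      exact hT (Finset.insert_erase hjT).symm
    · rfl

theorem exists_exteriorCoord_eq_single (S : Finset ι) :
    ∃ x ∈ ⋀[A]^S.card (ι → A), exteriorCoord A ι x = Pi.single S 1 := by
  induction S using Finset.induction_on with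
  | empty =>
    refine ⟨algebraMap A _ 1, ?_, exteriorCoord_algebraMap 1⟩
    rw [ExteriorAlgebra.exteriorPower, Finset.card_empty, pow_zero]
    exact Submodule.algebraMap_mem _
  | insert j S hj ih =>
    obtain ⟨x, hx, hxS⟩ := ih
    refine ⟨sgn A j S • (ExteriorAlgebra.ι A (Pi.single j 1) * x), ?_, ?_⟩
    · rw [ExteriorAlgebra.exteriorPower, Finset.card_insert_of_notMem hj, pow_succ']
      exact Submodule.smul_mem _ _ (Submodule.mul_mem_mul ⟨_, rfl⟩ hx)
    · rw [map_smul, exteriorCoord_ι_mul, hxS, vecWedge_apply,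
        Finset.sum_eq_single j (fun i _ hij => by rw [Pi.single_eq_of_ne hij, zero_smul]) (by simp),
        Pi.single_eq_same, one_smul, wedge_single hj, smul_smul, sgn_mul_self, one_smul]

theorem exists_exteriorCoord_eq {i : ℕ} {f : Finset ι → A} (hf : f ∈ chains A A Finset.univ i) :
    ∃ x ∈ ⋀[A]^i (ι → A), exteriorCoord A ι x = f := by
  choose x hx hxS using exists_exteriorCoord_eq_single (A := A) (ι := ι)
  refine ⟨∑ S, f S • x S, Submodule.sum_mem _ fun S _ => ?_, ?_⟩
  · by_cases h : f S = 0
    · rw [h, zero_smul]; exact zero_mem _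
    · obtain ⟨-, rfl⟩ := hf S h
      exact Submodule.smul_mem _ _ (hx S)
  · simp_rw [map_sum, map_smul, hxS]
    funext T
    simp [Finset.sum_apply, Pi.single_apply]

/-- Both sides are free with bases indexed by the finite subsets, so surjectivity suffices: a
surjective endomorphism of a finite module is injective. -/
theorem exteriorCoord_injective : Function.Injective (exteriorCoord A ι) := by
  let e := (Pi.basisFun A ι).ExteriorAlgebra.equivFun
  have hsurj : Function.Surjective (exteriorCoord A ι ∘ₗ e.symm.toLinearMap) := by
    intro f
    choose x _ hxS using exists_exteriorCoord_eq_single (A := A) (ι := ι)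
    refine ⟨e (∑ S, f S • x S), ?_⟩
    simp only [LinearMap.comp_apply, LinearEquiv.coe_coe, LinearEquiv.symm_apply_apply]
    simp_rw [map_sum, map_smul, hxS]
    funext T
    simp [Finset.sum_apply, Pi.single_apply]
  have hinj := OrzechProperty.injective_of_surjective_endomorphism _ hsurj
  intro x y hxy
  exact e.injective (hinj (by simpa using hxy))

/-- The coordinates of a Koszul cycle. -/
noncomputable def cycleCoord (h : ι → A) (i : ℕ) : cycles h i →ₗ[A] (Finset ι → A) :=
  exteriorCoord A ι ∘ₗ (cycles h i).subtype

theorem cycleCoord_injective (h : ι → A) (i : ℕ) : Function.Injective (cycleCoord h i) :=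
  exteriorCoord_injective.comp Subtype.val_injective

theorem cycleCoord_mem_chains (h : ι → A) (i : ℕ) (z : cycles h i) :
    cycleCoord h i z ∈ chains A A Finset.univ i :=
  exteriorCoord_mem_chains i z.1 z.2.1

theorem diff_cycleCoord (h : ι → A) (i : ℕ) (z : cycles h i) : diff A h (cycleCoord h i z) = 0 := by
  have hz : koszulD h z.1 = 0 := z.2.2
  change diff A h (exteriorCoord A ι z.1) = 0
  rw [← exteriorCoord_koszulD, hz, map_zero]

theorem exists_cycleCoord_eq (h : ι → A) {i : ℕ} {f : Finset ι → A}
    (hf : f ∈ chains A A Finset.univ i) (hdf : diff A h f = 0) : ∃ z, cycleCoord h i z = f := by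
  obtain ⟨x, hx, rfl⟩ := exists_exteriorCoord_eq hf
  exact ⟨⟨x, hx, exteriorCoord_injective (by rw [exteriorCoord_koszulD, hdf, map_zero])⟩, rfl⟩

theorem cycleCoord_coordContraction (h : ι → A) (i : ℕ) (j : ι) (z : cycles h (i + 1)) :
    cycleCoord h i (coordContraction h i j z) = contract A A j (cycleCoord h (i + 1) z) := by
  rw [← diff_single]
  exact exteriorCoord_koszulD _ _

/-- The coordinates of an element of the approximation complex. -/
noncomputable def approxCoord (h : ι → A) (i : ℕ) :
    ZModule h i →ₗ[MvPolynomial ι A] (Finset ι → MvPolynomial ι A) :=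
  (TensorProduct.piScalarRight A (MvPolynomial ι A) (MvPolynomial ι A)
    (Finset ι)).toLinearMap ∘ₗ (cycleCoord h i).baseChange (MvPolynomial ι A)

theorem approxCoord_tmul (h : ι → A) (i : ℕ) (p : MvPolynomial ι A) (z : cycles h i) :
    approxCoord h i (p ⊗ₜ z) =
      p • (Algebra.linearMap A (MvPolynomial ι A)).compLeft (Finset ι) (cycleCoord h i z) := by
  funext S
  simp [approxCoord, Algebra.smul_def, mul_comm]

/-- `A[T]` is flat over `A`. -/
theorem approxCoord_injective (h : ι → A) (i : ℕ) : Function.Injective (approxCoord h i) := by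
  have := Module.Flat.lTensor_preserves_injective_linearMap (M := MvPolynomial ι A)
    (cycleCoord h i) (cycleCoord_injective h i)
  exact (TensorProduct.piScalarRight A (MvPolynomial ι A) (MvPolynomial ι A)
    (Finset ι)).injective.comp this

theorem approxCoord_mem_chains (h : ι → A) (i : ℕ) (x : ZModule h i) :
    approxCoord h i x ∈ chains (MvPolynomial ι A) (MvPolynomial ι A) Finset.univ i := by
  induction x using TensorProduct.induction_on with
  | zero => rw [map_zero]; exact zero_mem _
  | add x y hx hy => rw [map_add]; exact add_mem hx hy
  | tmul p z =>
    rw [approxCoord_tmul]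
    exact Submodule.smul_mem _ _
      (comp_mem_chains (R := A) (Algebra.linearMap A (MvPolynomial ι A))
        (cycleCoord_mem_chains h i z))

theorem diff_approxCoord (h : ι → A) (i : ℕ) (x : ZModule h i) :
    diff (MvPolynomial ι A) (fun j => C (h j) : ι → MvPolynomial ι A) (approxCoord h i x) = 0 := by
  induction x using TensorProduct.induction_on with
  | zero => rw [map_zero, map_zero]
  | add x y hx hy => rw [map_add, map_add, hx, hy, add_zero]
  | tmul p z =>
    rw [approxCoord_tmul, map_smul, diff_C, diff_comp, diff_cycleCoord, map_zero, smul_zero]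

theorem approxCoord_epsilon (h : ι → A) (i : ℕ) (x : ZModule h (i + 1)) :
    approxCoord h i (epsilon h i x) =
      diff (MvPolynomial ι A) (X : ι → MvPolynomial ι A) (approxCoord h (i + 1) x) := by
  induction x using TensorProduct.induction_on with
  | zero => simp only [map_zero]
  | add x y hx hy => simp only [map_add, hx, hy]
  | tmul p z =>
    simp only [epsilon, LinearMap.sum_apply, LinearMap.smul_apply, LinearMap.baseChange_tmul,
      map_sum, map_smul, approxCoord_tmul, diff_apply]
    rw [Finset.smul_sum]
    refine Finset.sum_congr rfl fun j _ => ?_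
    rw [cycleCoord_coordContraction, contract_algebraMap (R := A) (S := MvPolynomial ι A),
      smul_comm p, ← diff_single, ← diff_single, diff_comp]

/-- The constants `h j` act coefficientwise, so each coefficient vector of a `δ`-cycle over `A[T]`
is a Koszul cycle over `A`. -/
theorem exists_approxCoord_eq (h : ι → A) {i : ℕ} {f : Finset ι → MvPolynomial ι A}
    (hf : f ∈ chains (MvPolynomial ι A) (MvPolynomial ι A) Finset.univ i)
    (hdf : diff (MvPolynomial ι A) (fun j => C (h j) : ι → MvPolynomial ι A) f = 0) :
    ∃ x, approxCoord h i x = f := by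
  classical
  have H : ∀ α, ∃ z, cycleCoord h i z = (lcoeff A α).compLeft (Finset ι) f := fun α =>
    exists_cycleCoord_eq h (comp_mem_chains (R := A) _ hf)
      (by rw [diff_comp, ← diff_C, hdf, map_zero])
  choose z hz using H
  let T : Finset (ι →₀ ℕ) := Finset.univ.biUnion fun S => (f S).support
  refine ⟨∑ α ∈ T, monomial α 1 ⊗ₜ z α, ?_⟩
  rw [map_sum]
  simp_rw [approxCoord_tmul, hz]
  funext S
  rw [Finset.sum_apply]
  conv_rhs => rw [← support_sum_monomial_coeff (f S)]
  have : ∀ α ∈ T, ((monomial α (1 : A)) • (Algebra.linearMap A (MvPolynomial ι A)).compLeft (Finset ι)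
      ((lcoeff A α).compLeft (Finset ι) f)) S = monomial α (coeff α (f S)) := fun α _ => by
    simp only [Pi.smul_apply, LinearMap.compLeft_apply, Function.comp_apply, lcoeff_apply,
      Algebra.linearMap_apply, algebraMap_eq, smul_eq_mul]
    rw [mul_comm, C_mul_monomial, mul_one]
  rw [Finset.sum_congr rfl this]
  refine (Finset.sum_subset (fun α hα => ?_) fun α _ hα => ?_).symm
  · exact Finset.mem_biUnion.2 ⟨S, Finset.mem_univ _, hα⟩
  · rw [notMem_support_iff.1 hα, map_zero]

end FinsetKoszul

open RingTheory.Sequence in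
theorem mainTheorem3 {K A : Type*} [Field K] [CommRing A] [Algebra K A]
    (𝒜 : ℕ → Submodule K A) [GradedAlgebra 𝒜]
    (hA₀ : ∀ a ∈ 𝒜 0, ∃ c : K, algebraMap K A c = a)
    (hCM : IsCohenMacaulay A)
    (m n : ℕ) (hmn : n ≤ m) (hdim : ringKrullDim A = m)
    (d : ℕ) (h : Fin (n + 1) → A) (hdeg : ∀ i, h i ∈ 𝒜 d)
    (hcodim : (n : ℕ∞) ≤ (Ideal.span (Set.range h)).height + 1)
    (hX : ProjLocallyDefinedBy 𝒜 (Ideal.span (Set.range h)) n) :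
    ApproximationComplex.IsAcyclic h ∧
      (1 ≤ (Ideal.span (Set.range h)).height →
        ApproximationComplex.cycles h (n + 1) = ⊥) := by
  have hN : IsNoetherianRing A := hCM.1
  refine ⟨fun i x => ⟨fun hx => ?_, ?_⟩, fun hI => ?_⟩
  -- For `n = 0` the truncated `n - 1` is `0` and the sequence is empty.
  · obtain ⟨as, hlen, hmem, has⟩ := hCM.exists_isWeaklyRegular (Ideal.span (Set.range h)) (n - 1)
      (by
        rw [ENat.natCast_sub, Nat.cast_one]
        exact tsub_le_iff_right.2 hcodim)
    have hy : Fintype.card (Fin (n + 1)) = 1 ∨ ∃ y, IsWeaklyRegular A (as ++ [y]) ∧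
        y ∈ (Ideal.span {s : A | ∃ j, s * h j ∈
          Ideal.span (h '' (Finset.univ.erase j : Finset (Fin (n + 1))))}).radical := by
      -- With a single generator there are no nonzero 2-chains. Otherwise `n - 1 < n ≤ m` leaves
      -- room for one more regular element in the irrelevant ideal.
      rcases Nat.eq_zero_or_pos n with hn | hn
      · left; simp [hn]
      · right
        have hht : (as.length : ℕ∞) < (HomogeneousIdeal.irrelevant 𝒜).toIdeal.height := by
          have h1 := ringKrullDim_le_height_irrelevant 𝒜 hA₀
          rw [hdim] at h1
          have h2 : (m : ℕ∞) ≤ (HomogeneousIdeal.irrelevant 𝒜).toIdeal.height := by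
            exact_mod_cast h1
          refine lt_of_lt_of_le ?_ h2
          exact_mod_cast (show as.length < m by omega)
        obtain ⟨y, hy, hreg⟩ := hCM.exists_isWeaklyRegular_append has _ hht
        exact ⟨y, hreg, hX.irrelevant_le_radical 𝒜 hn.ne' h hdeg hy⟩
    obtain ⟨r, hr, hδr, hεr⟩ := FinsetKoszul.exists_diff_X_eq_of_isWeaklyRegular h has hmem
      (by rw [Fintype.card_fin]; omega) hy (FinsetKoszul.approxCoord_mem_chains h (i + 1) x)
      (FinsetKoszul.diff_approxCoord h (i + 1) x)
      (by rw [← FinsetKoszul.approxCoord_epsilon, hx, map_zero])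
    obtain ⟨t, rfl⟩ := FinsetKoszul.exists_approxCoord_eq h hr hδr
    exact ⟨t, FinsetKoszul.approxCoord_injective h _ (by
      rw [FinsetKoszul.approxCoord_epsilon, hεr])⟩
  · rintro ⟨y, rfl⟩
    exact ApproximationComplex.epsilon_comp_epsilon h i y
  · obtain ⟨as, hlen, hmem, has⟩ := hCM.exists_isWeaklyRegular (Ideal.span (Set.range h)) 1
      (by exact_mod_cast hI)
    refine (Submodule.eq_bot_iff _).2 fun z hz => ?_
    -- One regular element in the ideal kills the top Koszul homology, and there are no nonzero
    -- chains of degree `n + 2` to bound a cycle.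
    obtain ⟨w, hw, hdw⟩ := FinsetKoszul.exists_diff_eq (U := Finset.univ) has (by simpa using hmem)
      (FinsetKoszul.cycleCoord_mem_chains h (n + 1) ⟨z, hz⟩)
      (FinsetKoszul.diff_cycleCoord h (n + 1) ⟨z, hz⟩) (by simp [hlen])
    rw [FinsetKoszul.eq_zero_of_card_lt (by simp) hw, map_zero] at hdw
    exact FinsetKoszul.exteriorCoord_injective (hdw.symm.trans (map_zero _).symm)
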